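/- Let $\mathbb F$ be a field, $\mathfrak g$ a Lie algebra over $\mathbb F$ and $V$ a vector space over $\mathbb F$; associative algebras have a unit. Let $\mathcal A$ be the associative algebra freely generated by $\mathfrak g$ and $V$, that is, $T(\mathfrak g\oplus V)$ modulo the relations $xy-yx=[x,y]$ ($x,y\in\mathfrak g$), with its canonical maps from $\mathfrak g$ and $V$. It is universal: for every associative algebra $B$, every Lie algebra map $\mathfrak g\to B$ (for the commutator bracket on $B$) and every linear map $V\to B$ there is a unique algebra map $\mathcal A\to B$ compatible with both. Equivalently, $\mathcal A$ is the algebra freely generated by the algebra $U(\mathfrak g)$ and $V$: algebra maps $U(\mathfrak g)\to B$ together with linear maps $V\to B$ extend uniquely to algebra maps $\mathcal A\to B$. The canonical maps $\mathfrak g\to U(\mathfrak g)\to\mathcal A$ and $V\to\mathcal A$ are injective, so that $\mathfrak g\subset U(\mathfrak g)\subset\mathcal A$ and $V\subset\mathcal A$. Let $\mathfrak a$ be the Lie subalgebra of $\mathcal A$ generated by $\mathfrak g$ and $V$. Then $\mathfrak a$ is the Lie algebra freely generated by $\mathfrak g$ and $V$: for every Lie algebra $\mathfrak b$, every Lie algebra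 map $\mathfrak g\to\mathfrak b$ and every linear map $V\to\mathfrak b$ there is a unique Lie algebra map $\mathfrak a\to\mathfrak b$ compatible with both. Moreover, the inclusion $\mathfrak a\subset\mathcal A$ extends to an algebra isomorphism $U(\mathfrak a)\cong\mathcal A$. Regard $U(\mathfrak g)$ as a Hopf algebra with $\Delta(x)=x\otimes1+1\otimes x$, $\epsilon(x)=0$ and $S(x)=-x$ for $x\in\mathfrak g$. The action of $U(\mathfrak g)$ on $\mathcal A$ that extends the adjoint action $x\cdot a=xa-ax$ of $\mathfrak g$ is the adjoint action $h\cdot a=\sum_i h_{1i}\,a\,S(h_{2i})$, where $\Delta(h)=\sum_i h_{1i}\otimes h_{2i}$. Let $U(\mathfrak g)\cdot V\subset\mathcal A$ be the span of all $h\cdot v$ with $h\in U(\mathfrak g)$ and $v\in V$ under this action. For a vector space $W$, let $T(W)$ be the tensor algebra and $F(W)$ the free Lie algebra over $W$. 1. $U(\mathfrak g)\cdot V$ is the $\mathfrak g$-submodule of $\mathcal A$ generated by $V$, it lies in $\mathfrak a$, and it is the free $U(\mathfrak g)$-module over $V$: there is an isomorphism of $U(\mathfrak g)$-modules $U(\mathfrak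 g)\otimes V\to U(\mathfrak g)\cdot V$ with $1\otimes v\mapsto v$. 2. The inclusion of $U(\mathfrak g)\cdot V$ in $\mathcal A$ extends to an isomorphism from $T(U(\mathfrak g)\cdot V)$ onto the associative subalgebra of $\mathcal A$ generated by $U(\mathfrak g)\cdot V$, and to an isomorphism from $F(U(\mathfrak g)\cdot V)$ onto the Lie subalgebra of $\mathcal A$, and of $\mathfrak a$, generated by $U(\mathfrak g)\cdot V$. 3. The action of $U(\mathfrak g)$ on $\mathcal A$ restricts to $T(U(\mathfrak g)\cdot V)$ and makes it a $U(\mathfrak g)$-module algebra, and multiplication in $\mathcal A$, $t\otimes h\mapsto th$, is an isomorphism of algebras from the smash product $T(U(\mathfrak g)\cdot V)\,\#\,U(\mathfrak g)$ onto $\mathcal A$; here the smash product is the space $T(U(\mathfrak g)\cdot V)\otimes U(\mathfrak g)$ with product $(s\otimes h)(t\otimes k)=\sum_i s\,(h_{1i}\cdot t)\otimes h_{2i}k$. Furthermore $\mathfrak a=F(U(\mathfrak g)\cdot V)\rtimes\mathfrak g$, that is, the inclusions of $F(U(\mathfrak g)\cdot V)$ and $\mathfrak g$ in $\mathfrak a$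 together give an isomorphism of Lie algebras from a semidirect product of $\mathfrak g$ with the ideal $F(U(\mathfrak g)\cdot V)$ onto $\mathfrak a$, and $F(U(\mathfrak g)\cdot V)$ is the ideal of $\mathfrak a$ generated by $V$. -/

import Mathlib

open scoped TensorProduct

/- The bracket on an associative algebra is the commutator. -/
attribute [local instance 100] LieRing.ofAssociativeRing

noncomputable section

/-! ### The Hopf algebra structure of a universal enveloping algebra -/

namespace UniversalEnvelopingAlgebra

variable (R : Type*) (L : Type*) [CommRing R] [LieRing L] [LieAlgebra R L]

variable {R L} in
theorem induction_on_gen {P : UniversalEnvelopingAlgebra R L → Prop}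
    (halg : ∀ r : R, P (algebraMap R _ r)) (hgen : ∀ x : L, P (ι R x))
    (hmul : ∀ a b, P a → P b → P (a * b)) (hadd : ∀ a b, P a → P b → P (a + b))
    (u : UniversalEnvelopingAlgebra R L) : P u := by
  let S : Subalgebra R (UniversalEnvelopingAlgebra R L) :=
    { carrier := {u | P u}
      mul_mem' := fun ha hb => hmul _ _ ha hb
      add_mem' := fun ha hb => hadd _ _ ha hb
      algebraMap_mem' := halg }
  let f : L →ₗ⁅R⁆ S :=
    { toFun := fun x => ⟨ι R x, hgen x⟩
      map_add' := fun x y => Subtype.ext (map_add (ι R) x y)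
      map_smul' := fun r x => Subtype.ext (map_smul (ι R) r x)
      map_lie' := fun {x y} => Subtype.ext (LieHom.map_lie (ι R) x y) }
  have h : S.val.comp (lift R f) = AlgHom.id R _ := by
    refine hom_ext R (LieHom.ext fun x => ?_)
    change S.val (lift R f (ι R x)) = ι R x
    rw [lift_ι_apply]
    rfl
  have h2 := DFunLike.congr_fun h u
  have h3 : (lift R f u : UniversalEnvelopingAlgebra R L) = u := h2
  rw [← h3]
  exact (lift R f u).2

variable {R L} in
theorem algHom_ext {B : Type*} [Semiring B] [Algebra R B]
    {f g : UniversalEnvelopingAlgebra R L →ₐ[R] B} (h : ∀ x, f (ι R x) = g (ι R x)) : f = g := by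
  refine AlgHom.ext fun u => ?_
  induction u using induction_on_gen with
  | halg r => rw [AlgHom.commutes, AlgHom.commutes]
  | hgen x => exact h x
  | hmul a b ha hb => rw [map_mul, map_mul, ha, hb]
  | hadd a b ha hb => rw [map_add, map_add, ha, hb]

/-- The comultiplication, with `Δ(x) = x ⊗ 1 + 1 ⊗ x` for `x ∈ L`. -/
def comulHom : UniversalEnvelopingAlgebra R L →ₐ[R]
    UniversalEnvelopingAlgebra R L ⊗[R] UniversalEnvelopingAlgebra R L :=
  lift R
    { toFun := fun x => ι R x ⊗ₜ[R] 1 + 1 ⊗ₜ[R] ι R x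
      map_add' := fun x y => by
        rw [map_add, TensorProduct.add_tmul, TensorProduct.tmul_add]; abel
      map_smul' := fun r x => by
        rw [map_smul, TensorProduct.tmul_smul, ← TensorProduct.smul_tmul', smul_add]; rfl
      map_lie' := fun {x y} => by
        simp only [LieHom.map_lie, LieRing.of_associative_ring_bracket,
          TensorProduct.sub_tmul, TensorProduct.tmul_sub, mul_add, add_mul,
          Algebra.TensorProduct.tmul_mul_tmul, one_mul, mul_one]
        abel }

/-- The counit, vanishing on `L`. -/
def counitHom : UniversalEnvelopingAlgebra R L →ₐ[R] R := lift R (0 : L →ₗ⁅R⁆ R)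

/-- The antipode as an algebra homomorphism to the opposite algebra, with `S(x) = -x` for
`x ∈ L`. -/
def antipodeHom : UniversalEnvelopingAlgebra R L →ₐ[R] (UniversalEnvelopingAlgebra R L)ᵐᵒᵖ :=
  lift R
    { toFun := fun x => MulOpposite.op (-ι R x)
      map_add' := fun x y => by rw [map_add, neg_add, MulOpposite.op_add]
      map_smul' := fun r x => by
        rw [map_smul, ← smul_neg, MulOpposite.op_smul]; rfl
      map_lie' := fun {x y} => by
        simp only [LieHom.map_lie, LieRing.of_associative_ring_bracket, ← MulOpposite.op_mul,
          ← MulOpposite.op_sub]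
        congr 1
        noncomm_ring }

theorem comulHom_ι (x : L) :
    comulHom R L (ι R x) = ι R x ⊗ₜ[R] 1 + 1 ⊗ₜ[R] ι R x := lift_ι_apply ..

theorem counitHom_ι (x : L) : counitHom R L (ι R x) = 0 := lift_ι_apply ..

theorem antipodeHom_ι (x : L) : antipodeHom R L (ι R x) = MulOpposite.op (-ι R x) :=
  lift_ι_apply ..

instance instBialgebra : Bialgebra R (UniversalEnvelopingAlgebra R L) :=
  Bialgebra.ofAlgHom (comulHom R L) (counitHom R L)
    (by
      refine algHom_ext fun x => ?_
      simp [comulHom_ι, TensorProduct.add_tmul, TensorProduct.tmul_add,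
        Algebra.TensorProduct.one_def, -ι_apply, add_assoc])
    (by
      refine algHom_ext fun x => ?_
      simp [comulHom_ι, counitHom_ι, -ι_apply])
    (by
      refine algHom_ext fun x => ?_
      simp [comulHom_ι, counitHom_ι, -ι_apply])

/-- The antipode. -/
def antipodeLinear : UniversalEnvelopingAlgebra R L →ₗ[R] UniversalEnvelopingAlgebra R L :=
  (MulOpposite.opLinearEquiv R).symm.toLinearMap ∘ₗ (antipodeHom R L).toLinearMap

theorem antipodeLinear_ι (x : L) : antipodeLinear R L (ι R x) = -ι R x := by
  simp [antipodeLinear, antipodeHom_ι, -ι_apply]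

theorem antipodeLinear_algebraMap (r : R) :
    antipodeLinear R L (algebraMap R _ r) = algebraMap R _ r := by
  simp [antipodeLinear]

theorem antipodeLinear_mul (a b : UniversalEnvelopingAlgebra R L) :
    antipodeLinear R L (a * b) = antipodeLinear R L b * antipodeLinear R L a := by
  simp [antipodeLinear]

theorem antipode_left (u : UniversalEnvelopingAlgebra R L) :
    LinearMap.mul' R _ ((antipodeLinear R L).rTensor _ (comulHom R L u)) =
      algebraMap R _ (counitHom R L u) := by
  induction u using induction_on_gen with
  | halg r =>
    rw [AlgHom.commutes, AlgHom.commutes, Algebra.TensorProduct.algebraMap_apply]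
    simp [antipodeLinear_algebraMap]
  | hgen x =>
    have h1 : antipodeLinear R L 1 = 1 := by simpa using antipodeLinear_algebraMap R L 1
    rw [comulHom_ι, counitHom_ι]
    simp [antipodeLinear_ι, h1, -ι_apply]
  | hadd a b ha hb => simp only [map_add, ha, hb]
  | hmul a b ha hb =>
    rw [map_mul (comulHom R L), map_mul (counitHom R L), map_mul (algebraMap R _)]
    have key : ∀ s t : UniversalEnvelopingAlgebra R L ⊗[R] UniversalEnvelopingAlgebra R L,
        ∀ r : R, LinearMap.mul' R _ ((antipodeLinear R L).rTensor _ s) = algebraMap R _ r →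
        LinearMap.mul' R _ ((antipodeLinear R L).rTensor _ (s * t)) =
          algebraMap R _ r * LinearMap.mul' R _ ((antipodeLinear R L).rTensor _ t) := by
      intro s t r hs
      induction t with
      | zero => simp
      | add t t' h h' => simp only [mul_add, map_add, h, h']
      | tmul c d =>
        have : LinearMap.mul' R _ ((antipodeLinear R L).rTensor _ (s * c ⊗ₜ[R] d)) =
            antipodeLinear R L c *
              LinearMap.mul' R _ ((antipodeLinear R L).rTensor _ s) * d := by
          clear hs
          induction s with
          | zero => simp
          | add s s' h h' => simp only [add_mul, mul_add, map_add, h, h']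
          | tmul e f =>
            simp [antipodeLinear_mul, mul_assoc]
        rw [this, hs, ← Algebra.commutes r]
        simp [mul_assoc]
    rw [key _ _ _ ha, hb]

theorem antipode_right (u : UniversalEnvelopingAlgebra R L) :
    LinearMap.mul' R _ ((antipodeLinear R L).lTensor _ (comulHom R L u)) =
      algebraMap R _ (counitHom R L u) := by
  induction u using induction_on_gen with
  | halg r =>
    have h1 : antipodeLinear R L 1 = 1 := by simpa using antipodeLinear_algebraMap R L 1
    rw [AlgHom.commutes, AlgHom.commutes, Algebra.TensorProduct.algebraMap_apply]
    simp [h1]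
  | hgen x =>
    have h1 : antipodeLinear R L 1 = 1 := by simpa using antipodeLinear_algebraMap R L 1
    rw [comulHom_ι, counitHom_ι]
    simp [antipodeLinear_ι, h1, -ι_apply]
  | hadd a b ha hb => simp only [map_add, ha, hb]
  | hmul a b ha hb =>
    rw [map_mul (comulHom R L), map_mul (counitHom R L), map_mul (algebraMap R _)]
    have key : ∀ s t : UniversalEnvelopingAlgebra R L ⊗[R] UniversalEnvelopingAlgebra R L,
        ∀ r : R, LinearMap.mul' R _ ((antipodeLinear R L).lTensor _ t) = algebraMap R _ r →
        LinearMap.mul' R _ ((antipodeLinear R L).lTensor _ (s * t)) =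
          LinearMap.mul' R _ ((antipodeLinear R L).lTensor _ s) * algebraMap R _ r := by
      intro s t r ht
      induction s with
      | zero => simp
      | add s s' h h' => simp only [add_mul, map_add, h, h']
      | tmul c d =>
        have : LinearMap.mul' R _ ((antipodeLinear R L).lTensor _ (c ⊗ₜ[R] d * t)) =
            c * LinearMap.mul' R _ ((antipodeLinear R L).lTensor _ t) *
              antipodeLinear R L d := by
          clear ht
          induction t with
          | zero => simp
          | add s s' h h' => simp only [add_mul, mul_add, map_add, h, h']
          | tmul e f =>
            simp [antipodeLinear_mul, mul_assoc]
        rw [this, ht, mul_assoc, Algebra.commutes r]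
        simp [mul_assoc]
    rw [key _ _ _ hb, ha]

instance instHopfAlgebra : HopfAlgebra R (UniversalEnvelopingAlgebra R L) where
  antipode := antipodeLinear R L
  mul_antipode_rTensor_comul := LinearMap.ext (antipode_left R L)
  mul_antipode_lTensor_comul := LinearMap.ext (antipode_right R L)

end UniversalEnvelopingAlgebra

/-! ### Adjoint action, module algebras and smash products -/

/-- For an algebra homomorphism `φ : H → C` from a Hopf algebra, the adjoint action
`h · c = ∑ φ(h₁) c φ(S(h₂))` of `H` on `C`. -/
def hopfAdjoint {R H C : Type*} [CommRing R] [Ring H] [HopfAlgebra R H] [Ring C] [Algebra R C]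
    (φ : H →ₐ[R] C) : H →ₗ[R] Module.End R C :=
  LinearMap.mul' R (Module.End R C) ∘ₗ
    TensorProduct.map
      (LinearMap.mul R C ∘ₗ φ.toLinearMap)
      ((LinearMap.mul R C).flip ∘ₗ φ.toLinearMap ∘ₗ HopfAlgebra.antipode R) ∘ₗ
    Coalgebra.comul

/-- The structure of an `H`-module algebra on the algebra `A`, for a bialgebra `H`: an action of
`H` on `A` with `h · (ab) = ∑ (h₁ · a)(h₂ · b)` and `h · 1 = ε(h) 1`. -/
structure ModuleAlgebraStr (R H A : Type*) [CommRing R] [Ring H] [Bialgebra R H]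
    [Ring A] [Algebra R A] where
  /-- the action -/
  act : H →ₐ[R] Module.End R A
  act_mul : ∀ (h : H) (a b : A), act h (a * b) =
    LinearMap.mul' R A (TensorProduct.map (act.toLinearMap.flip a) (act.toLinearMap.flip b)
      (Coalgebra.comul (R := R) h))
  act_one : ∀ h : H, act h 1 = Coalgebra.counit (R := R) h • (1 : A)

/-- The smash product `A # H` of an `H`-module algebra `A` with the bialgebra `H`: the vector
space `A ⊗ H` with the multiplication `(a ⊗ h)(b ⊗ k) = ∑ a (h₁ · b) ⊗ h₂ k`
(see `SmashProduct.mk_mul_mk`). -/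
def SmashProduct {R H A : Type*} [CommRing R] [Ring H] [Bialgebra R H] [Ring A] [Algebra R A]
    (_ρ : ModuleAlgebraStr R H A) : Type _ := A ⊗[R] H

namespace SmashProduct

variable {R H A : Type*} [CommRing R] [Ring H] [Bialgebra R H] [Ring A] [Algebra R A]
  (ρ : ModuleAlgebraStr R H A)

instance : AddCommGroup (SmashProduct ρ) := inferInstanceAs (AddCommGroup (A ⊗[R] H))

instance : Module R (SmashProduct ρ) := inferInstanceAs (Module R (A ⊗[R] H))

/-- The element `a ⊗ h` of `A # H`. -/
def mk (a : A) (h : H) : SmashProduct ρ := (a ⊗ₜ[R] h : A ⊗[R] H)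

/-- `A` acts on `A ⊗ H` by multiplication on the left factor. -/
def leftHom : A →ₐ[R] Module.End R (A ⊗[R] H) :=
  (Module.endTensorEndAlgHom (R := R) (S := R) (A := R) (M := A) (N := H)).comp
    (Algebra.TensorProduct.includeLeft.comp (Algebra.lmul R A))

/-- `H` acts diagonally on `A ⊗ H`, by `h · (a ⊗ k) = ∑ h₁ · a ⊗ h₂ k`. -/
def diagHom : H →ₐ[R] Module.End R (A ⊗[R] H) :=
  ((Module.endTensorEndAlgHom (R := R) (S := R) (A := R) (M := A) (N := H)).comp
    (Algebra.TensorProduct.map ρ.act (Algebra.lmul R H))).comp (Bialgebra.comulAlgHom R H)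

/-- The multiplication, `(a ⊗ h) y = a (h · y)`. -/
def mulHom : A ⊗[R] H →ₗ[R] Module.End R (A ⊗[R] H) :=
  LinearMap.mul' R (Module.End R (A ⊗[R] H)) ∘ₗ
    TensorProduct.map (leftHom (R := R) (H := H) (A := A)).toLinearMap (diagHom ρ).toLinearMap

theorem leftHom_tmul (a b : A) (h : H) :
    leftHom (R := R) (H := H) a (b ⊗ₜ[R] h) = (a * b) ⊗ₜ[R] h := by
  change (a * b) ⊗ₜ[R] ((1 : Module.End R H) h) = _
  rfl

theorem diagHom_tmul (h : H) (b : A) (k : H) :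
    diagHom ρ h (b ⊗ₜ[R] k) =
      TensorProduct.map (ρ.act.toLinearMap.flip b) (LinearMap.mulRight R k)
        (Coalgebra.comul (R := R) h) := by
  simp only [diagHom, AlgHom.comp_apply, Bialgebra.comulAlgHom_apply]
  induction Coalgebra.comul (R := R) h with
  | zero => simp
  | add s t hs ht => simp only [map_add, LinearMap.add_apply, hs, ht]
  | tmul x y => rfl

theorem mulHom_tmul (a : A) (h : H) :
    mulHom ρ (a ⊗ₜ[R] h) = leftHom a * diagHom ρ h := by
  simp [mulHom]

theorem mulHom_tmul_tmul (a b : A) (h k : H) :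
    mulHom ρ (a ⊗ₜ[R] h) (b ⊗ₜ[R] k) =
      TensorProduct.map (LinearMap.mulLeft R a ∘ₗ ρ.act.toLinearMap.flip b)
        (LinearMap.mulRight R k) (Coalgebra.comul (R := R) h) := by
  rw [mulHom_tmul, Module.End.mul_apply, diagHom_tmul]
  induction Coalgebra.comul (R := R) h with
  | zero => simp
  | add s t hs ht => simp only [map_add, hs, ht]
  | tmul x y => simp [leftHom_tmul]

theorem diag_mul_left (h : H) (a : A) :
    diagHom ρ h * leftHom a = mulHom ρ (diagHom ρ h (a ⊗ₜ[R] 1)) := by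
  refine TensorProduct.ext' fun b k => ?_
  rw [Module.End.mul_apply, leftHom_tmul, diagHom_tmul, diagHom_tmul]
  let T : H ⊗[R] (H ⊗[R] H) →ₗ[R] A ⊗[R] H :=
    TensorProduct.map
      (LinearMap.mul' R A ∘ₗ
        TensorProduct.map (ρ.act.toLinearMap.flip a) (ρ.act.toLinearMap.flip b))
      (LinearMap.mulRight R k) ∘ₗ (TensorProduct.assoc R H H H).symm.toLinearMap
  have hL : ∀ z : H ⊗[R] H,
      TensorProduct.map (ρ.act.toLinearMap.flip (a * b)) (LinearMap.mulRight R k) z =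
        T (TensorProduct.assoc R H H H ((Coalgebra.comul (R := R) (A := H)).rTensor H z)) := by
    intro z
    induction z with
    | zero => simp
    | add s t hs ht => simp only [map_add, hs, ht]
    | tmul x y => simp [T, ρ.act_mul]
  have hR : ∀ z : H ⊗[R] H,
      mulHom ρ (TensorProduct.map (ρ.act.toLinearMap.flip a) (LinearMap.mulRight R 1) z)
          (b ⊗ₜ[R] k) =
        T ((Coalgebra.comul (R := R) (A := H)).lTensor H z) := by
    intro z
    induction z with
    | zero => simp
    | add s t hs ht => simp only [map_add, LinearMap.add_apply, hs, ht]
    | tmul x y =>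
      rw [TensorProduct.map_tmul, mulHom_tmul_tmul, LinearMap.lTensor_tmul,
        LinearMap.mulRight_apply, mul_one]
      induction Coalgebra.comul (R := R) y with
      | zero => simp
      | add s t hs ht => simp only [map_add, TensorProduct.tmul_add, hs, ht]
      | tmul y z => simp [T]
  rw [hL, hR, Coalgebra.coassoc_apply]

theorem mulHom_mulHom (x y : A ⊗[R] H) :
    mulHom ρ (mulHom ρ x y) = mulHom ρ x * mulHom ρ y := by
  have hl : ∀ (a : A) (z : A ⊗[R] H), mulHom ρ (leftHom a z) = leftHom a * mulHom ρ z := by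
    intro a z
    induction z with
    | zero => simp
    | add s t hs ht => simp only [map_add, mul_add, hs, ht]
    | tmul b k => rw [leftHom_tmul, mulHom_tmul, mulHom_tmul, map_mul, mul_assoc]
  have hr : ∀ (h : H) (z : A ⊗[R] H),
      mulHom ρ (TensorProduct.map LinearMap.id (LinearMap.mulRight R h) z) =
        mulHom ρ z * diagHom ρ h := by
    intro h z
    induction z with
    | zero => simp
    | add s t hs ht => simp only [map_add, add_mul, hs, ht]
    | tmul b k =>
      rw [TensorProduct.map_tmul, mulHom_tmul, mulHom_tmul, mul_assoc, ← map_mul]; rfl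
  induction x with
  | zero => simp
  | add s t hs ht => simp only [map_add, LinearMap.add_apply, add_mul, hs, ht]
  | tmul a h =>
  induction y with
  | zero => simp
  | add s t hs ht => simp only [map_add, mul_add, hs, ht]
  | tmul b k =>
    have h1 : diagHom ρ h (b ⊗ₜ[R] k) =
        TensorProduct.map LinearMap.id (LinearMap.mulRight R k) (diagHom ρ h (b ⊗ₜ[R] 1)) := by
      rw [diagHom_tmul, diagHom_tmul]
      induction Coalgebra.comul (R := R) h with
      | zero => simp
      | add s t hs ht => simp only [map_add, hs, ht]
      | tmul x y => simp
    rw [mulHom_tmul, Module.End.mul_apply, hl, h1, hr, ← diag_mul_left, mulHom_tmul]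
    simp only [mul_assoc]

instance : Mul (SmashProduct ρ) := ⟨fun x y => mulHom ρ x y⟩

instance : One (SmashProduct ρ) := ⟨mk ρ 1 1⟩

theorem one_mul_aux (x : A ⊗[R] H) : mulHom ρ ((1 : A) ⊗ₜ[R] (1 : H)) x = x := by
  rw [mulHom_tmul, map_one, map_one]; rfl

theorem mul_one_aux (x : A ⊗[R] H) : mulHom ρ x ((1 : A) ⊗ₜ[R] (1 : H)) = x := by
  induction x with
  | zero => simp
  | add s t hs ht => simp only [map_add, LinearMap.add_apply, hs, ht]
  | tmul a h =>
    rw [mulHom_tmul_tmul]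
    have h1 := Coalgebra.rTensor_counit_comul (R := R) h
    have h2 : ∀ z : H ⊗[R] H,
        TensorProduct.map (LinearMap.mulLeft R a ∘ₗ ρ.act.toLinearMap.flip 1)
          (LinearMap.mulRight R 1) z =
        TensorProduct.map (LinearMap.toSpanSingleton R A a) LinearMap.id
          ((Coalgebra.counit (R := R) (A := H)).rTensor H z) := by
      intro z
      induction z with
      | zero => simp
      | add s t hs ht => simp only [map_add, hs, ht]
      | tmul x y => simp [ρ.act_one]
    rw [h2, h1]
    simp

instance : Ring (SmashProduct ρ) :=
  { (inferInstance : AddCommGroup (SmashProduct ρ)) with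
    mul := (· * ·)
    one := 1
    left_distrib := fun x y z => map_add (mulHom ρ x) y z
    right_distrib := fun x y z => LinearMap.map_add₂ (mulHom ρ) x y z
    zero_mul := fun x => LinearMap.map_zero₂ (mulHom ρ) x
    mul_zero := fun x => map_zero (mulHom ρ x)
    mul_assoc := fun x y z => LinearMap.congr_fun (mulHom_mulHom ρ x y) z
    one_mul := one_mul_aux ρ
    mul_one := mul_one_aux ρ }

instance : Algebra R (SmashProduct ρ) :=
  Algebra.ofModule (fun r x y => LinearMap.map_smul₂ (mulHom ρ) r x y)
    (fun r x y => map_smul (mulHom ρ x) r y)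

theorem mk_mul_mk (a b : A) (h k : H) {ι : Type*} (r : Coalgebra.Repr R h ι) :
    mk ρ a h * mk ρ b k =
      ∑ i ∈ r.index, mk ρ (a * ρ.act (r.left i) b) (r.right i * k) := by
  change mulHom ρ (a ⊗ₜ[R] h) (b ⊗ₜ[R] k) = _
  rw [mulHom_tmul_tmul, ← r.eq, map_sum]
  rfl

end SmashProduct

/-! ### The free Lie algebra over a module -/

/-- The ideal of linear relations: it is generated by the elements `[x + y] - ([x] + [y])` and
`[r x] - r [x]` of the free Lie algebra on the underlying set of `W`. -/
def freeLieRel (R W : Type*) [CommRing R] [AddCommGroup W] [Module R W] :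
    LieIdeal R (FreeLieAlgebra R W) :=
  LieSubmodule.lieSpan R (FreeLieAlgebra R W)
    ({z | ∃ x y : W, z = .of R (x + y) - (.of R x + .of R y)} ∪
      {z | ∃ (r : R) (x : W), z = .of R (r • x) - r • .of R x})

/-- The free Lie algebra `F(W)` over an `R`-module `W`: the free Lie algebra on the underlying set
of `W`, modulo the linear relations that hold in `W`. -/
abbrev FreeLieOver (R W : Type*) [CommRing R] [AddCommGroup W] [Module R W] : Type _ :=
  FreeLieAlgebra R W ⧸ freeLieRel R W

namespace FreeLieOver

variable (R : Type*) {W : Type*} [CommRing R] [AddCommGroup W] [Module R W]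

/-- The canonical linear map `W → F(W)`. -/
def ι : W →ₗ[R] FreeLieOver R W where
  toFun x := LieSubmodule.Quotient.mk (FreeLieAlgebra.of R x)
  map_add' x y := by
    refine (Submodule.Quotient.eq (freeLieRel R W).toSubmodule).2 ?_
    exact LieSubmodule.subset_lieSpan (Or.inl ⟨x, y, rfl⟩)
  map_smul' r x := by
    refine (Submodule.Quotient.eq (freeLieRel R W).toSubmodule).2 ?_
    exact LieSubmodule.subset_lieSpan (Or.inr ⟨r, x, rfl⟩)

/-- The universal property of `F(W)`. -/
theorem existsUnique_lift {L : Type*} [LieRing L] [LieAlgebra R L] (f : W →ₗ[R] L) :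
    ∃! h : FreeLieOver R W →ₗ⁅R⁆ L, ∀ w, h (ι R w) = f w := by
  let g : FreeLieAlgebra R W →ₗ⁅R⁆ L := FreeLieAlgebra.lift R f
  have hg : ∀ w, g (.of R w) = f w := fun w => FreeLieAlgebra.lift_of_apply f w
  have hker : freeLieRel R W ≤ g.ker := by
    refine LieSubmodule.lieSpan_le.2 ?_
    rintro z (⟨x, y, rfl⟩ | ⟨r, x, rfl⟩)
    · simp [LieHom.mem_ker, hg]
    · simp [LieHom.mem_ker, hg]
  let h0 : FreeLieOver R W →ₗ[R] L :=
    (freeLieRel R W).toSubmodule.liftQ g.toLinearMap (fun z hz => LieHom.mem_ker.1 (hker hz))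
  let h : FreeLieOver R W →ₗ⁅R⁆ L :=
    { h0 with
      map_lie' := fun {x y} => by
        induction x using Submodule.Quotient.induction_on with | H x =>
        induction y using Submodule.Quotient.induction_on with | H y =>
        exact LieHom.map_lie g x y }
  refine ⟨h, fun w => hg w, fun k hk => ?_⟩
  let q : FreeLieAlgebra R W →ₗ⁅R⁆ FreeLieOver R W :=
    { (LieSubmodule.Quotient.mk' (freeLieRel R W)).toLinearMap with
      map_lie' := fun {_ _} => rfl }
  have hkg : k.comp q = h.comp q :=
    FreeLieAlgebra.hom_ext fun x => (hk x).trans (hg x).symm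
  refine LieHom.ext fun z => ?_
  induction z using Submodule.Quotient.induction_on with | H z =>
  exact LieHom.congr_fun hkg z

end FreeLieOver

/-! ### The algebra freely generated by a Lie algebra and a vector space -/

/-- The relations `x y - y x = [x, y]` for `x, y ∈ L`, in `T(L ⊕ V)`. -/
inductive FreeAlgOver.Rel (R L V : Type*) [CommRing R] [LieRing L] [LieAlgebra R L]
    [AddCommGroup V] [Module R V] :
    TensorAlgebra R (L × V) → TensorAlgebra R (L × V) → Prop
  | lie_compat (x y : L) : FreeAlgOver.Rel R L V
      (TensorAlgebra.ι R (x, 0) * TensorAlgebra.ι R (y, 0) -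
        TensorAlgebra.ι R (y, 0) * TensorAlgebra.ι R (x, 0))
      (TensorAlgebra.ι R (⁅x, y⁆, 0))

/-- The associative unital algebra freely generated by the Lie algebra `L` and the module `V`:
the quotient of the tensor algebra `T(L ⊕ V)` by the relations `x y - y x = [x, y]`, for
`x, y ∈ L`. -/
def FreeAlgOver (R L V : Type*) [CommRing R] [LieRing L] [LieAlgebra R L]
    [AddCommGroup V] [Module R V] : Type _ :=
  RingQuot (FreeAlgOver.Rel R L V)

namespace FreeAlgOver

variable (R L V : Type*) [CommRing R] [LieRing L] [LieAlgebra R L] [AddCommGroup V] [Module R V]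

instance : Ring (FreeAlgOver R L V) := inferInstanceAs (Ring (RingQuot (Rel R L V)))

instance : Algebra R (FreeAlgOver R L V) := inferInstanceAs (Algebra R (RingQuot (Rel R L V)))

/-- The quotient map from `T(L ⊕ V)`. -/
def quot : TensorAlgebra R (L × V) →ₐ[R] FreeAlgOver R L V := RingQuot.mkAlgHom R (Rel R L V)

/-- The canonical Lie algebra homomorphism from `L`. -/
def inL : L →ₗ⁅R⁆ FreeAlgOver R L V :=
  { (quot R L V).toLinearMap ∘ₗ TensorAlgebra.ι R ∘ₗ LinearMap.inl R L V with
    map_lie' := fun {x y} => by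
      have h := RingQuot.mkAlgHom_rel R (Rel.lie_compat (R := R) (V := V) x y)
      rw [map_sub, map_mul, map_mul] at h
      exact h.symm }

/-- The canonical linear map from `V`. -/
def inV : V →ₗ[R] FreeAlgOver R L V :=
  (quot R L V).toLinearMap ∘ₗ TensorAlgebra.ι R ∘ₗ LinearMap.inr R L V

/-- The canonical algebra homomorphism from the universal enveloping algebra of `L`. -/
def inU : UniversalEnvelopingAlgebra R L →ₐ[R] FreeAlgOver R L V :=
  UniversalEnvelopingAlgebra.lift R (inL R L V)

/-- The action of `U(L)` on the free algebra that extends the adjoint action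
`x · a = x a - a x` of `L`. -/
def adU : UniversalEnvelopingAlgebra R L →ₐ[R] Module.End R (FreeAlgOver R L V) :=
  UniversalEnvelopingAlgebra.lift R ((LieAlgebra.ad R (FreeAlgOver R L V)).comp (inL R L V))

/-- `U(L) · V`: the subspace spanned by the elements `u · v`, that is, the submodule generated by
`V` under the adjoint action. -/
def UV : Submodule R (FreeAlgOver R L V) :=
  Submodule.span R {a | ∃ (u : UniversalEnvelopingAlgebra R L) (v : V),
    a = adU R L V u (inV R L V v)}

/-- The Lie subalgebra generated by `L` and `V`. -/
def lieSub : LieSubalgebra R (FreeAlgOver R L V) :=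
  LieSubalgebra.lieSpan R (FreeAlgOver R L V) (Set.range (inL R L V) ∪ Set.range (inV R L V))

/-- The canonical Lie algebra homomorphism from `L` to the Lie subalgebra generated by `L` and
`V`. -/
def lieInL : L →ₗ⁅R⁆ lieSub R L V where
  toFun x := ⟨inL R L V x, LieSubalgebra.subset_lieSpan (Or.inl ⟨x, rfl⟩)⟩
  map_add' x y := Subtype.ext (map_add (inL R L V) x y)
  map_smul' r x := Subtype.ext (map_smul (inL R L V) r x)
  map_lie' {x y} := Subtype.ext (LieHom.map_lie (inL R L V) x y)

/-- The canonical linear map from `V` to the Lie subalgebra generated by `L` and `V`. -/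
def lieInV : V →ₗ[R] lieSub R L V where
  toFun v := ⟨inV R L V v, LieSubalgebra.subset_lieSpan (Or.inr ⟨v, rfl⟩)⟩
  map_add' x y := Subtype.ext (map_add (inV R L V) x y)
  map_smul' r x := Subtype.ext (map_smul (inV R L V) r x)

end FreeAlgOver

end

/-! ### Injectivity of the canonical map to the universal enveloping algebra -/

namespace UniversalEnvelopingAlgebra

namespace PBW

/-! Write `L` for the given Lie algebra and `𝒜` for the free algebra. Three facts carry the proof.

The first is the injectivity of `L → U(L)` for `L` free as a module (`PBW.rep_injective`). It is
proved by letting `L` act on polynomials in an ordered basis, so that a basis element acts as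
multiplication up to lower degree; the existence of this action comes down to the Jacobi identity.
Injectivity lets questions about Lie algebras be answered in associative ones. A Lie map from `𝔞` to
`𝔟` is found by mapping `𝒜` to `U(𝔟)` and observing that `𝔞` lands in `𝔟`. Likewise `F(W)` embeds in
`T(W)`, because `F(W) → U(F(W))` factors through `T(W)`.

The second is a representation of `𝒜` on `R × (U(L) ⊗ V)` in which `u · v` sends `(1, 0)` to `(0, u
⊗ v)`; hence `U(L) ⊗ V → U(L) · V` is injective.

The third is the smash product. The adjoint action on `U(L) · V` extends by derivations to `T =
T(U(L) · V)` and makes it a module algebra. Multiplication `T # U(L) → 𝒜` is an algebra map by `h c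
= ∑ (h₁ · c) h₂` (`adMul_comul`), and the universal property of `𝒜` gives an inverse `toSmash`. In
particular `T → 𝒜` is injective, and so is `F(U(L) · V) → T → 𝒜`.

For the semidirect product, `F(U(L) · V)` is stable under `ad L` inside `𝔞`, its sum with `L` is a
Lie subalgebra containing the generators, and the projection `𝒜 → U(L)` that kills `V` separates the
two summands. -/

theorem exists_least {κ : Type*} [LinearOrder κ] {s : Multiset κ} (hs : s ≠ 0) :
    ∃ j ∈ s, ∀ k ∈ s, j ≤ k := by
  obtain ⟨a, ha⟩ := Multiset.exists_mem_of_ne_zero hs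
  have hne : s.toFinset.Nonempty := ⟨a, Multiset.mem_toFinset.2 ha⟩
  exact ⟨_, Multiset.mem_toFinset.1 (s.toFinset.min'_mem hne),
    fun k hk => s.toFinset.min'_le k (Multiset.mem_toFinset.2 hk)⟩

theorem exists_least_of_not_le {κ : Type*} [LinearOrder κ] {s : Multiset κ} {i : κ}
    (h : ¬ ∀ k ∈ s, i ≤ k) : ∃ j ∈ s, ∀ k ∈ s, j ≤ k :=
  exists_least fun h0 => h (by simp [h0])

variable {R L κ : Type*} [CommRing R] [LieRing L] [LieAlgebra R L] [LinearOrder κ]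
  (b : Module.Basis κ R L)

open Classical in
/-- The action of a basis element on the monomials in the ordered basis `b`. -/
noncomputable def monomialAct (i : κ) (s : Multiset κ) : Multiset κ →₀ R :=
  if h : ∀ k ∈ s, i ≤ k then Finsupp.single (i ::ₘ s) 1 else
    -- Let `j` be the least element of `s` and `t = s - j`, so that `j < i`. The bracket relation
    -- forces `i·(j·t) = j·(i·t) + [i, j]·t`. The leading monomial `i ::ₘ t` of `i·t` contributes `i
    -- ::ₘ s`, since `j` is least; the remainder of `i·t` has lower degree and is treated
    -- recursively. The test `τ.card < s.card` serves termination only and holds for every term that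
    -- occurs.
    have : (s.erase (exists_least_of_not_le h).choose).card < s.card :=
      Multiset.card_erase_lt_of_mem (exists_least_of_not_le h).choose_spec.1
    Finsupp.single (i ::ₘ s) 1 +
      ((monomialAct i (s.erase (exists_least_of_not_le h).choose) -
          Finsupp.single (i ::ₘ s.erase (exists_least_of_not_le h).choose) 1).sum fun τ c =>
        if _ : τ.card < s.card then c • monomialAct (exists_least_of_not_le h).choose τ else 0) +
      (b.repr ⁅b i, b (exists_least_of_not_le h).choose⁆).sum fun k c =>
        c • monomialAct k (s.erase (exists_least_of_not_le h).choose)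
termination_by s.card

/-- The operator on polynomials given by a basis element. -/
noncomputable def basisOp (i : κ) : Module.End R (Multiset κ →₀ R) :=
  Finsupp.linearCombination R (monomialAct b i)

/-- The operator on polynomials given by an element of the Lie algebra. -/
noncomputable def op : L →ₗ[R] Module.End R (Multiset κ →₀ R) := b.constr R (basisOp b)

theorem op_basis (i : κ) : op b (b i) = basisOp b i := b.constr_basis R _ i

theorem basisOp_single (i : κ) (s : Multiset κ) :
    basisOp b i (Finsupp.single s 1) = monomialAct b i s := by
  simp [basisOp]

theorem op_eq_sum (x : L) (s : Multiset κ) :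
    op b x (Finsupp.single s 1) = (b.repr x).sum fun k c => c • monomialAct b k s := by
  rw [op, Module.Basis.constr_apply, Finsupp.sum, LinearMap.sum_apply, Finsupp.sum]
  simp [basisOp_single]

theorem monomialAct_of_le {i : κ} {s : Multiset κ} (h : ∀ k ∈ s, i ≤ k) :
    monomialAct b i s = Finsupp.single (i ::ₘ s) 1 := by
  rw [monomialAct, dif_pos h]

/-- The span of the monomials of degree at most `n`. -/
def degreeLE (R κ : Type*) [CommRing R] (n : ℕ) : Submodule R (Multiset κ →₀ R) :=
  Finsupp.supported R R {s | s.card ≤ n}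

theorem degreeLE_mono {R κ : Type*} [CommRing R] {m n : ℕ} (h : m ≤ n) :
    degreeLE R κ m ≤ degreeLE R κ n :=
  Finsupp.supported_mono fun _ hs => le_trans hs h

theorem single_mem_degreeLE {R κ : Type*} [CommRing R] {s : Multiset κ} {n : ℕ}
    (h : s.card ≤ n) (c : R) :
    Finsupp.single s c ∈ degreeLE R κ n :=
  Finsupp.single_mem_supported R c h

/-- Every term after the first in the recursion comes from a monomial of smaller degree, and an
action raises degree by at most one. This bound also shows that the cutoff in the recursion discards
nothing. -/
theorem monomialAct_sub_mem (i : κ) (s : Multiset κ) :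
    monomialAct b i s - Finsupp.single (i ::ₘ s) 1 ∈ degreeLE R κ s.card := by
  induction hn : s.card using Nat.strong_induction_on generalizing i s with
  | _ n ih =>
  subst hn
  have hlow : ∀ (j : κ) (t : Multiset κ), t.card < s.card →
      monomialAct b j t ∈ degreeLE R κ s.card := by
    intro j t ht
    rw [← sub_add_cancel (monomialAct b j t) (Finsupp.single (j ::ₘ t) 1)]
    exact add_mem (degreeLE_mono ht.le (ih _ ht j t rfl))
      (single_mem_degreeLE (by rw [Multiset.card_cons]; exact ht) _)
  rw [monomialAct]
  split_ifs with h
  · simp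
  · have hc := Multiset.card_erase_lt_of_mem (exists_least_of_not_le h).choose_spec.1
    rw [add_assoc, add_sub_cancel_left]
    refine add_mem (Submodule.sum_mem _ fun τ _ => ?_)
      (Submodule.sum_mem _ fun k _ => Submodule.smul_mem _ _ (hlow _ _ hc))
    dsimp only
    split_ifs with hτ
    · exact Submodule.smul_mem _ _ (hlow _ _ hτ)
    · exact zero_mem _

/-- For `j` least, `j·t` is the monomial `j ::ₘ t`, and the recursive definition of `i·(j ::ₘ t)` is
the required relation. -/
theorem basisOp_basisOp_single {i j : κ} {t : Multiset κ} (hji : j ≤ i) (hj : ∀ k ∈ t, j ≤ k) :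
    basisOp b i (basisOp b j (Finsupp.single t 1)) =
      basisOp b j (basisOp b i (Finsupp.single t 1)) + op b ⁅b i, b j⁆ (Finsupp.single t 1) := by
  have hjt : basisOp b j (Finsupp.single t 1) = Finsupp.single (j ::ₘ t) 1 := by
    rw [basisOp_single, monomialAct_of_le b hj]
  rcases hji.eq_or_lt with rfl | hlt
  · simp
  have hn : ¬ ∀ k ∈ j ::ₘ t, i ≤ k := fun h => (h j (Multiset.mem_cons_self _ _)).not_gt hlt
  have hl : (exists_least_of_not_le hn).choose = j := by
    obtain ⟨h1, h2⟩ := (exists_least_of_not_le hn).choose_spec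
    refine le_antisymm (h2 j (Multiset.mem_cons_self _ _)) ?_
    rcases Multiset.mem_cons.1 h1 with h | h
    · exact h.ge
    · exact hj _ h
  have hjit : ∀ k ∈ i ::ₘ t, j ≤ k := by
    intro k hk
    rcases Multiset.mem_cons.1 hk with rfl | hk
    · exact hji
    · exact hj k hk
  rw [hjt, basisOp_single, monomialAct, dif_neg hn]
  simp only [hl, Multiset.erase_cons_head]
  rw [op_eq_sum]
  congr 1
  rw [basisOp_single, ← sub_add_cancel (monomialAct b i t) (Finsupp.single (i ::ₘ t) 1), map_add,
    basisOp_single, monomialAct_of_le b hjit, Multiset.cons_swap, add_comm, sub_add_cancel]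
  congr 1
  rw [basisOp, Finsupp.linearCombination_apply]
  refine Finsupp.sum_congr fun τ hτ => ?_
  have h1 : τ.card ≤ t.card :=
    (Finsupp.mem_supported R _).1 (monomialAct_sub_mem b i t) (Finset.mem_coe.2 hτ)
  -- The cutoff test succeeds: `τ` has degree at most that of `t`, one less than that of `j ::ₘ t`.
  rw [dif_pos (by rw [Multiset.card_cons]; omega)]

/-- Induction on degree. For basis elements `i`, `j`, the case where one of them is at most
everything in `t` is the definition, up to antisymmetry. Otherwise write `t = k·s` with `k` least;
`k` can be moved to the front past both `i` and `j`, and the two orders then differ by a Jacobi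
identity. -/
theorem op_op_single (t : Multiset κ) (x y : L) :
    op b x (op b y (Finsupp.single t 1)) =
      op b y (op b x (Finsupp.single t 1)) + op b ⁅x, y⁆ (Finsupp.single t 1) := by
  induction hn : t.card using Nat.strong_induction_on generalizing t x y with
  | _ n ih =>
  subst hn
  have hlow : ∀ m < t.card, ∀ v ∈ degreeLE R κ m, ∀ x y,
      op b x (op b y v) = op b y (op b x v) + op b ⁅x, y⁆ v := by
    intro m hm v hv x y
    have : degreeLE R κ m ≤ LinearMap.eqLocus (op b x ∘ₗ op b y)
        (op b y ∘ₗ op b x + op b ⁅x, y⁆) := by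
      rw [degreeLE, Finsupp.supported_eq_span_single, Submodule.span_le]
      rintro _ ⟨s, hs, rfl⟩
      exact ih _ (lt_of_le_of_lt hs hm) s x y rfl
    exact this hv
  suffices key : ∀ i j, op b (b i) (op b (b j) (Finsupp.single t 1)) =
      op b (b j) (op b (b i) (Finsupp.single t 1)) + op b ⁅b i, b j⁆ (Finsupp.single t 1) by
    let f₁ : L →ₗ[R] L →ₗ[R] (Multiset κ →₀ R) :=
      LinearMap.mk₂ R (fun x y => op b x (op b y (Finsupp.single t 1)))
        (by simp) (by simp) (by simp) (by simp)
    let f₂ : L →ₗ[R] L →ₗ[R] (Multiset κ →₀ R) :=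
      LinearMap.mk₂ R (fun x y => op b y (op b x (Finsupp.single t 1)) +
        op b ⁅x, y⁆ (Finsupp.single t 1))
        (by intros; simp; abel) (by intros; simp) (by intros; simp; abel) (by intros; simp)
    have : f₁ = f₂ := b.ext fun i => b.ext fun j => key i j
    exact LinearMap.congr_fun₂ this x y
  have hA : ∀ i j, (∀ k ∈ t, j ≤ k) → op b (b i) (op b (b j) (Finsupp.single t 1)) =
      op b (b j) (op b (b i) (Finsupp.single t 1)) + op b ⁅b i, b j⁆ (Finsupp.single t 1) := by
    intro i j hj
    simp only [op_basis]
    rcases le_total j i with h | h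
    · exact basisOp_basisOp_single b h hj
    · rw [basisOp_basisOp_single b h fun k hk => h.trans (hj k hk), ← lie_skew (b i) (b j), map_neg,
        LinearMap.neg_apply, add_neg_cancel_right]
  intro i j
  by_cases hj : ∀ k ∈ t, j ≤ k
  · exact hA i j hj
  by_cases hi : ∀ k ∈ t, i ≤ k
  · rw [hA j i hi, ← lie_skew (b i) (b j), map_neg, LinearMap.neg_apply,
      add_neg_cancel_right]
  obtain ⟨k, hkt, hk⟩ := exists_least_of_not_le hj
  have hki : k ≤ i := le_of_not_ge fun h => hi fun l hl => h.trans (hk l hl)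
  have hkj : k ≤ j := le_of_not_ge fun h => hj fun l hl => h.trans (hk l hl)
  obtain ⟨s, rfl⟩ := Multiset.exists_cons_of_mem hkt
  have hks : ∀ l ∈ s, k ≤ l := fun l hl => hk l (Multiset.mem_cons_of_mem hl)
  have hcard : s.card < (k ::ₘ s).card := by simp
  have hz : Finsupp.single (k ::ₘ s) (1 : R) = op b (b k) (Finsupp.single s 1) := by
    rw [op_basis, basisOp_single, monomialAct_of_le b hks]
  have hs := hlow _ hcard (Finsupp.single s 1) (single_mem_degreeLE le_rfl 1)
  -- The vector `j·s` has the degree of `t`, so the induction hypothesis does not cover it. Its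
  -- leading monomial `j ::ₘ s` is handled because `k` is least, its remainder by induction.
  have hB : ∀ i j, k ≤ i → k ≤ j → op b (b i) (op b (b k) (op b (b j) (Finsupp.single s 1))) =
      op b (b k) (op b (b i) (op b (b j) (Finsupp.single s 1))) +
        op b ⁅b i, b k⁆ (op b (b j) (Finsupp.single s 1)) := by
    intro i j hki hkj
    have h1 : op b (b j) (Finsupp.single s 1) =
        Finsupp.single (j ::ₘ s) 1 + (monomialAct b j s - Finsupp.single (j ::ₘ s) 1) := by
      rw [op_basis, basisOp_single, add_sub_cancel]
    have hkjs : ∀ l ∈ j ::ₘ s, k ≤ l := by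
      intro l hl
      rcases Multiset.mem_cons.1 hl with rfl | hl
      · exact hkj
      · exact hks l hl
    have h2 := basisOp_basisOp_single b hki hkjs
    simp only [← op_basis] at h2
    have h3 := hlow _ hcard _ (monomialAct_sub_mem b j s) (b i) (b k)
    rw [h1]
    simp only [map_add] at h2 h3 ⊢
    rw [h2, h3]
    abel
  have hexp : ∀ i j, k ≤ i → k ≤ j →
      op b (b i) (op b (b j) (op b (b k) (Finsupp.single s 1))) =
      op b (b k) (op b (b i) (op b (b j) (Finsupp.single s 1))) +
        op b ⁅b i, b k⁆ (op b (b j) (Finsupp.single s 1)) +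
        op b ⁅b j, b k⁆ (op b (b i) (Finsupp.single s 1)) +
        op b ⁅b i, ⁅b j, b k⁆⁆ (Finsupp.single s 1) := by
    intro i j hki hkj
    rw [hs (b j) (b k), map_add, hB i j hki hkj, hs (b i) ⁅b j, b k⁆]
    abel
  -- The mixed terms in `hexp` are symmetric in `i` and `j` and cancel. What remains is `[[i, j], k]
  -- = [i, [j, k]] - [j, [i, k]]`, applied to `s`.
  rw [hz, hexp i j hki hkj, hexp j i hkj hki, hs (b i) (b j), map_add, hs ⁅b i, b j⁆ (b k),
    lie_lie (b i) (b j) (b k), map_sub, LinearMap.sub_apply]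
  abel

/-- The representation of `L` on polynomials in the ordered basis `b`. -/
noncomputable def rep : L →ₗ⁅R⁆ Module.End R (Multiset κ →₀ R) :=
  { op b with
    map_lie' := fun {x y} => by
      refine Finsupp.lhom_ext' fun t => LinearMap.ext_ring ?_
      have h := op_op_single b t x y
      simp only [LieRing.of_associative_ring_bracket]
      change op b ⁅x, y⁆ (Finsupp.single t 1) = op b x (op b y (Finsupp.single t 1)) -
        op b y (op b x (Finsupp.single t 1))
      rw [h, add_sub_cancel_left] }

/-- Acting on the empty monomial turns `x` into the linear polynomial with the same coordinates. -/
theorem rep_injective : Function.Injective (rep b) := by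
  refine (injective_iff_map_eq_zero (rep b)).2 fun x hx => ?_
  have h1 : op b x (Finsupp.single 0 1) = 0 := LinearMap.congr_fun hx _
  have h2 : (b.repr x).mapDomain (fun k => ({k} : Multiset κ)) = 0 := by
    rw [← h1, op_eq_sum, Finsupp.mapDomain]
    refine Finsupp.sum_congr fun k _ => ?_
    rw [monomialAct_of_le b (by simp), Finsupp.smul_single, smul_eq_mul, mul_one]
    rfl
  have h3 : b.repr x = 0 :=
    Finsupp.mapDomain_injective (fun _ _ h => Multiset.singleton_inj.1 h) (by simpa using h2)
  simpa using h3

end PBW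

/-- If `L` is a free module, the canonical map to its enveloping algebra is injective. -/
theorem ι_injective (R L : Type*) [CommRing R] [LieRing L] [LieAlgebra R L] [Module.Free R L] :
    Function.Injective (ι R : L → UniversalEnvelopingAlgebra R L) := by
  let b := Module.Free.chooseBasis R L
  -- Any linear order on the basis will do.
  let _ : LinearOrder (Module.Free.ChooseBasisIndex R L) :=
    IsWellOrder.linearOrder WellOrderingRel
  intro x y h
  apply PBW.rep_injective b
  rw [← lift_ι_apply R (PBW.rep b) x, h, lift_ι_apply]

end UniversalEnvelopingAlgebra

/-! ### The Hopf adjoint action of an enveloping algebra -/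

/-- On an enveloping algebra, the Hopf adjoint action is an algebra homomorphism. -/
theorem hopfAdjoint_eq_lift {R L C : Type*} [CommRing R] [LieRing L] [LieAlgebra R L] [Ring C]
    [Algebra R C] (φ : UniversalEnvelopingAlgebra R L →ₐ[R] C)
    (ad : UniversalEnvelopingAlgebra R L →ₐ[R] Module.End R C)
    (had : ∀ x c, ad (.ι R x) c = φ (.ι R x) * c - c * φ (.ι R x))
    (u : UniversalEnvelopingAlgebra R L) : ad u = hopfAdjoint φ u := by
  -- Right multiplication and the antipode both reverse products, so `S` preserves them. It commutes
  -- with left multiplication, so the two combine into an algebra map `T` on `U(L) ⊗ U(L)`. The Hopf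
  -- adjoint action is then `T ∘ Δ`, an algebra map, and can be compared with `ad` on generators.
  let S : UniversalEnvelopingAlgebra R L →ₐ[R] Module.End R C :=
    AlgHom.ofLinearMap
      ((LinearMap.mul R C).flip ∘ₗ φ.toLinearMap ∘ₗ
        UniversalEnvelopingAlgebra.antipodeLinear R L)
      (by
        ext c
        have h := UniversalEnvelopingAlgebra.antipodeLinear_algebraMap R L 1
        rw [map_one] at h
        simp [h])
      (by
        intro a b
        ext c
        simp [UniversalEnvelopingAlgebra.antipodeLinear_mul, mul_assoc])
  let T : UniversalEnvelopingAlgebra R L ⊗[R] UniversalEnvelopingAlgebra R L →ₐ[R]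
      Module.End R C :=
    Algebra.TensorProduct.lift ((Algebra.lmul R C).comp φ) S
      (fun a b => by
        refine LinearMap.ext fun c => ?_
        simp [S, mul_assoc])
  have hTt : ∀ x y, T (x ⊗ₜ y) = Algebra.lmul R C (φ x) * S y := fun x y =>
    Algebra.TensorProduct.lift_tmul _ _ _ x y
  have hT : ∀ u, hopfAdjoint φ u = T.comp (UniversalEnvelopingAlgebra.comulHom R L) u := by
    intro u
    have key : ∀ z, LinearMap.mul' R (Module.End R C)
        (TensorProduct.map (LinearMap.mul R C ∘ₗ φ.toLinearMap)
          ((LinearMap.mul R C).flip ∘ₗ φ.toLinearMap ∘ₗ HopfAlgebra.antipode R) z) = T z := by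
      intro z
      induction z with
      | zero => simp
      | add s t hs ht => simp only [map_add, hs, ht]
      | tmul x y =>
        rw [hTt]
        rfl
    exact key _
  rw [hT]
  congr 1
  refine UniversalEnvelopingAlgebra.algHom_ext fun x => ?_
  ext c
  rw [had, AlgHom.comp_apply, UniversalEnvelopingAlgebra.comulHom_ι]
  rw [map_add, hTt, hTt, map_one S]
  simp [S, UniversalEnvelopingAlgebra.antipodeLinear_ι, sub_eq_add_neg,
    -UniversalEnvelopingAlgebra.ι_apply]

namespace FreeAlgOver

/-! ### Universal properties -/

section Lift

variable {R L V B : Type*} [CommRing R] [LieRing L] [LieAlgebra R L] [AddCommGroup V] [Module R V]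
  [Ring B] [Algebra R B]

/-- The algebra homomorphism extending a Lie algebra homomorphism and a linear map. -/
noncomputable def lift (f : L →ₗ⁅R⁆ B) (g : V →ₗ[R] B) : FreeAlgOver R L V →ₐ[R] B :=
  RingQuot.liftAlgHom R ⟨TensorAlgebra.lift R ((f : L →ₗ[R] B).coprod g), by
    rintro _ _ ⟨x, y⟩
    simp [LieRing.of_associative_ring_bracket]⟩

@[simp]
theorem lift_inL (f : L →ₗ⁅R⁆ B) (g : V →ₗ[R] B) (x : L) : lift f g (inL R L V x) = f x := by
  have : lift f g (RingQuot.mkAlgHom R _ (TensorAlgebra.ι R (x, 0))) = f x := by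
    rw [lift]
    erw [RingQuot.liftAlgHom_mkAlgHom_apply]
    simp
  exact this

@[simp]
theorem lift_inV (f : L →ₗ⁅R⁆ B) (g : V →ₗ[R] B) (v : V) : lift f g (inV R L V v) = g v := by
  have : lift f g (RingQuot.mkAlgHom R _ (TensorAlgebra.ι R (0, v))) = g v := by
    rw [lift]
    erw [RingQuot.liftAlgHom_mkAlgHom_apply]
    simp
  exact this

theorem hom_ext {h k : FreeAlgOver R L V →ₐ[R] B} (hL : ∀ x, h (inL R L V x) = k (inL R L V x))
    (hV : ∀ v, h (inV R L V v) = k (inV R L V v)) : h = k := by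
  refine RingQuot.ringQuot_ext' R h k (TensorAlgebra.hom_ext (LinearMap.ext fun p => ?_))
  obtain ⟨x, v⟩ := p
  have hp : ((x, v) : L × V) = (x, 0) + (0, v) := by simp
  rw [hp, map_add, map_add]
  exact congrArg₂ (· + ·) (hL x) (hV v)

@[simp]
theorem inU_ι (x : L) : inU R L V (.ι R x) = inL R L V x :=
  UniversalEnvelopingAlgebra.lift_ι_apply ..

theorem adU_ι (x : L) (a : FreeAlgOver R L V) : adU R L V (.ι R x) a = ⁅inL R L V x, a⁆ := by
  rw [adU, UniversalEnvelopingAlgebra.lift_ι_apply]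
  rfl

theorem existsUnique_lift (f : L →ₗ⁅R⁆ B) (g : V →ₗ[R] B) :
    ∃! h : FreeAlgOver R L V →ₐ[R] B,
      (∀ x, h (inL R L V x) = f x) ∧ ∀ v, h (inV R L V v) = g v :=
  ⟨lift f g, ⟨lift_inL f g, lift_inV f g⟩, fun _ hk =>
    hom_ext (fun x => by rw [hk.1, lift_inL]) (fun v => by rw [hk.2, lift_inV])⟩

theorem existsUnique_liftU (f : UniversalEnvelopingAlgebra R L →ₐ[R] B) (g : V →ₗ[R] B) :
    ∃! h : FreeAlgOver R L V →ₐ[R] B,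
      (∀ u, h (inU R L V u) = f u) ∧ ∀ v, h (inV R L V v) = g v := by
  let f' : L →ₗ⁅R⁆ B := (f : UniversalEnvelopingAlgebra R L →ₗ⁅R⁆ B).comp
    (UniversalEnvelopingAlgebra.ι R)
  refine ⟨lift f' g, ⟨fun u => ?_, lift_inV f' g⟩, fun k hk =>
    hom_ext (fun x => ?_) (fun v => by rw [hk.2, lift_inV])⟩
  · have : (lift f' g).comp (inU R L V) = f :=
      UniversalEnvelopingAlgebra.algHom_ext fun x => by
        rw [AlgHom.comp_apply, inU_ι, lift_inL]
        rfl
    exact DFunLike.congr_fun this u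
  · rw [lift_inL, ← inU_ι, hk.1]
    rfl

variable (R L V)

/-- Sending `V` to zero gives a retraction onto `U(L)`. -/
theorem inU_injective : Function.Injective (inU R L V) := by
  obtain ⟨h, ⟨h1, -⟩, -⟩ := existsUnique_liftU (V := V)
    (AlgHom.id R (UniversalEnvelopingAlgebra R L)) 0
  exact Function.LeftInverse.injective h1

theorem inV_injective : Function.Injective (inV R L V) := by
  let h : FreeAlgOver R L V →ₐ[R] TensorAlgebra R V :=
    lift (0 : L →ₗ⁅R⁆ TensorAlgebra R V) (TensorAlgebra.ι R)
  intro v w hvw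
  have := congrArg h hvw
  simp only [h, lift_inV] at this
  exact TensorAlgebra.ι_leftInverse.injective this

/-- The projection onto the enveloping algebra that vanishes on `V`. -/
noncomputable def toU : FreeAlgOver R L V →ₐ[R] UniversalEnvelopingAlgebra R L :=
  lift (UniversalEnvelopingAlgebra.ι R) 0

end Lift

/-! ### The Lie subalgebra generated by `L` and `V` -/

section LieSub

variable (R L V : Type*) [CommRing R] [LieRing L] [LieAlgebra R L] [AddCommGroup V] [Module R V]

theorem lieSub_induction {p : lieSub R L V → Prop} (hL : ∀ x, p (lieInL R L V x))
    (hV : ∀ v, p (lieInV R L V v)) (h0 : p 0) (hadd : ∀ a b, p a → p b → p (a + b))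
    (hsmul : ∀ (r : R) a, p a → p (r • a)) (hlie : ∀ a b, p a → p b → p ⁅a, b⁆)
    (a : lieSub R L V) : p a := by
  obtain ⟨a, ha⟩ := a
  induction ha using LieSubalgebra.lieSpan_induction with
  | mem x hx =>
    rcases hx with ⟨x, rfl⟩ | ⟨v, rfl⟩
    · exact hL x
    · exact hV v
  | zero => exact h0
  | add x y hx hy h1 h2 => exact hadd _ _ h1 h2
  | smul r x hx h => exact hsmul r _ h
  | lie x y hx hy h1 h2 => exact hlie _ _ h1 h2

theorem lieSub_hom_ext {𝔟 : Type*} [LieRing 𝔟] [LieAlgebra R 𝔟] {h k : lieSub R L V →ₗ⁅R⁆ 𝔟}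
    (hL : ∀ x, h (lieInL R L V x) = k (lieInL R L V x))
    (hV : ∀ v, h (lieInV R L V v) = k (lieInV R L V v)) : h = k := by
  refine LieHom.ext fun a => ?_
  induction a using lieSub_induction with
  | hL x => exact hL x
  | hV v => exact hV v
  | h0 => simp
  | hadd a b ha hb => simp [ha, hb]
  | hsmul r a ha => simp [ha]
  | hlie a b ha hb => simp [ha, hb]

/-- The elements of `𝔞` that the induced map `H : 𝒜 → U(𝔟)` sends into `𝔟` are closed under the Lie
operations and include the generators, so all of `𝔞` lands in `𝔟`. Freeness of `𝔟` as a module makes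
`𝔟 → U(𝔟)` injective, so preimages are unique and inherit the homomorphism identities. -/
theorem lieSub_existsUnique_lift {𝔟 : Type*} [LieRing 𝔟] [LieAlgebra R 𝔟] [Module.Free R 𝔟]
    (f : L →ₗ⁅R⁆ 𝔟) (g : V →ₗ[R] 𝔟) :
    ∃! h : lieSub R L V →ₗ⁅R⁆ 𝔟,
      (∀ x, h (lieInL R L V x) = f x) ∧ ∀ v, h (lieInV R L V v) = g v := by
  let i : 𝔟 →ₗ⁅R⁆ UniversalEnvelopingAlgebra R 𝔟 := UniversalEnvelopingAlgebra.ι R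
  have hi : Function.Injective i := UniversalEnvelopingAlgebra.ι_injective R 𝔟
  let H : FreeAlgOver R L V →ₐ[R] UniversalEnvelopingAlgebra R 𝔟 :=
    lift (i.comp f) ((i : 𝔟 →ₗ[R] _) ∘ₗ g)
  have hHL : ∀ x, i (f x) = H (inL R L V x) := fun x => (lift_inL (i.comp f) _ x).symm
  have hHV : ∀ v, i (g v) = H (inV R L V v) := fun v => (lift_inV (i.comp f) ((i : 𝔟 →ₗ[R] _) ∘ₗ g) v).symm
  have hex : ∀ a : lieSub R L V, ∃ c, i c = H a := by
    intro a
    induction a using lieSub_induction with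
    | hL x => exact ⟨f x, hHL x⟩
    | hV v => exact ⟨g v, hHV v⟩
    | h0 => exact ⟨0, by simp⟩
    | hadd a b ha hb =>
      obtain ⟨c, hc⟩ := ha
      obtain ⟨d, hd⟩ := hb
      exact ⟨c + d, by rw [map_add, hc, hd, ← map_add]; rfl⟩
    | hsmul r a ha =>
      obtain ⟨c, hc⟩ := ha
      exact ⟨r • c, by rw [map_smul, hc, ← map_smul]; rfl⟩
    | hlie a b ha hb =>
      obtain ⟨c, hc⟩ := ha
      obtain ⟨d, hd⟩ := hb
      refine ⟨⁅c, d⁆, ?_⟩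
      rw [LieHom.map_lie, hc, hd, LieSubalgebra.coe_bracket]
      simp only [LieRing.of_associative_ring_bracket, map_sub, map_mul]
  choose h hh using hex
  let h' : lieSub R L V →ₗ⁅R⁆ 𝔟 :=
    { toFun := h
      map_add' := fun a b => hi (by rw [map_add, hh, hh, hh, ← map_add]; rfl)
      map_smul' := fun r a => hi (by
        rw [RingHom.id_apply, map_smul, hh, hh, ← map_smul]; rfl)
      map_lie' := fun {a b} => hi (by
        rw [LieHom.map_lie, hh, hh, hh, LieSubalgebra.coe_bracket]
        simp only [LieRing.of_associative_ring_bracket, map_sub, map_mul]) }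
  have h1 : ∀ x, h' (lieInL R L V x) = f x := fun x => hi ((hh _).trans (hHL x).symm)
  have h2 : ∀ v, h' (lieInV R L V v) = g v := fun v => hi ((hh _).trans (hHV v).symm)
  exact ⟨h', ⟨h1, h2⟩, fun k hk => lieSub_hom_ext R L V (fun x => (hk.1 x).trans (h1 x).symm)
    fun v => (hk.2 v).trans (h2 v).symm⟩

/-- The enveloping algebra of the Lie subalgebra generated by `L` and `V` is the free algebra. -/
noncomputable def lieSubEquiv :
    UniversalEnvelopingAlgebra R (lieSub R L V) ≃ₐ[R] FreeAlgOver R L V :=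
  AlgEquiv.ofAlgHom (UniversalEnvelopingAlgebra.lift R (lieSub R L V).incl)
    (lift ((UniversalEnvelopingAlgebra.ι R).comp (lieInL R L V))
      (((UniversalEnvelopingAlgebra.ι R :
        lieSub R L V →ₗ⁅R⁆ UniversalEnvelopingAlgebra R (lieSub R L V)) :
        lieSub R L V →ₗ[R] UniversalEnvelopingAlgebra R (lieSub R L V)) ∘ₗ lieInV R L V))
    (hom_ext
      (fun x => by
        rw [AlgHom.comp_apply, lift_inL, LieHom.comp_apply,
          UniversalEnvelopingAlgebra.lift_ι_apply]
        rfl)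
      (fun v => by
        rw [AlgHom.comp_apply, lift_inV, LinearMap.comp_apply, LieHom.coe_toLinearMap,
          UniversalEnvelopingAlgebra.lift_ι_apply]
        rfl))
    (by
      refine UniversalEnvelopingAlgebra.hom_ext R (lieSub_hom_ext R L V (fun x => ?_) fun v => ?_)
      · simp only [LieHom.comp_apply, AlgHom.coe_toLieHom, AlgHom.comp_apply,
          UniversalEnvelopingAlgebra.lift_ι_apply, AlgHom.id_apply]
        exact lift_inL _ _ x
      · simp only [LieHom.comp_apply, AlgHom.coe_toLieHom, AlgHom.comp_apply,
          UniversalEnvelopingAlgebra.lift_ι_apply, AlgHom.id_apply]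
        exact lift_inV _ _ v)

theorem lieSubEquiv_ι (a : lieSub R L V) :
    lieSubEquiv R L V (UniversalEnvelopingAlgebra.ι R a) = a :=
  UniversalEnvelopingAlgebra.lift_ι_apply R (lieSub R L V).incl a

theorem adU_eq_hopfAdjoint (u : UniversalEnvelopingAlgebra R L) :
    adU R L V u = hopfAdjoint (inU R L V) u :=
  hopfAdjoint_eq_lift _ _ (fun x c => by
    rw [adU_ι, inU_ι, LieRing.of_associative_ring_bracket]) u

end LieSub

/-! ### The submodule generated by `V` -/

section UV

variable {R L V : Type*} [CommRing R] [LieRing L] [LieAlgebra R L] [AddCommGroup V] [Module R V]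

theorem inV_mem_UV (v : V) : inV R L V v ∈ UV R L V :=
  Submodule.subset_span ⟨1, v, by simp⟩

theorem adU_mem_UV (u : UniversalEnvelopingAlgebra R L) {a : FreeAlgOver R L V}
    (ha : a ∈ UV R L V) : adU R L V u a ∈ UV R L V := by
  induction ha using Submodule.span_induction with
  | mem a ha =>
    obtain ⟨u', v, rfl⟩ := ha
    exact Submodule.subset_span ⟨u * u', v, by rw [map_mul]; rfl⟩
  | zero => simp
  | add a b _ _ ha hb => rw [map_add]; exact add_mem ha hb
  | smul r a _ ha => rw [map_smul]; exact Submodule.smul_mem _ _ ha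

theorem lie_mem_UV (x : L) {a : FreeAlgOver R L V} (ha : a ∈ UV R L V) :
    ⁅inL R L V x, a⁆ ∈ UV R L V := by
  rw [← adU_ι]
  exact adU_mem_UV _ ha

/-- Stability under `L` implies stability under `U(L)`, which `L` generates. This serves as the
induction principle for `U(L) · V`. -/
theorem UV_le {N : Submodule R (FreeAlgOver R L V)} (hV : ∀ v, inV R L V v ∈ N)
    (hL : ∀ x, ∀ a ∈ N, ⁅inL R L V x, a⁆ ∈ N) : UV R L V ≤ N := by
  have key : ∀ u : UniversalEnvelopingAlgebra R L, ∀ a ∈ N, adU R L V u a ∈ N := by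
    intro u
    induction u using UniversalEnvelopingAlgebra.induction_on_gen with
    | halg r =>
      intro a ha
      rw [AlgHom.commutes, Module.algebraMap_end_apply]
      exact N.smul_mem r ha
    | hgen x => intro a ha; rw [adU_ι]; exact hL x a ha
    | hmul u w hu hw => intro a ha; rw [map_mul]; exact hu _ (hw a ha)
    | hadd u w hu hw => intro a ha; rw [map_add]; exact add_mem (hu a ha) (hw a ha)
  rw [UV, Submodule.span_le]
  rintro _ ⟨u, v, rfl⟩
  exact key u _ (hV v)

variable (R L V)

theorem UV_isLeast : IsLeast {N : Submodule R (FreeAlgOver R L V) |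
    (∀ v, inV R L V v ∈ N) ∧ ∀ x, ∀ a ∈ N, ⁅inL R L V x, a⁆ ∈ N} (UV R L V) :=
  ⟨⟨inV_mem_UV, fun x _ => lie_mem_UV x⟩, fun _ hN => UV_le hN.1 hN.2⟩

theorem UV_le_lieSub : UV R L V ≤ (lieSub R L V).toSubmodule :=
  UV_le (fun v => (lieInV R L V v).2) fun x _ ha =>
    LieSubalgebra.lie_mem _ (lieInL R L V x).2 ha

/-- The map `u ⊗ v ↦ u · v`. -/
noncomputable def tensorToUV : UniversalEnvelopingAlgebra R L ⊗[R] V →ₗ[R] UV R L V :=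
  (TensorProduct.lift ((adU R L V).toLinearMap.compl₂ (inV R L V))).codRestrict (UV R L V)
    (fun t => by
      induction t with
      | zero => simp
      | add s t hs ht => rw [map_add]; exact add_mem hs ht
      | tmul u v => exact adU_mem_UV u (inV_mem_UV v))

theorem tensorToUV_tmul (u : UniversalEnvelopingAlgebra R L) (v : V) :
    (tensorToUV R L V (u ⊗ₜ v) : FreeAlgOver R L V) = adU R L V u (inV R L V v) := rfl

theorem tensorToUV_smul (u : UniversalEnvelopingAlgebra R L)
    (t : UniversalEnvelopingAlgebra R L ⊗[R] V) :
    (tensorToUV R L V (u • t) : FreeAlgOver R L V) = adU R L V u (tensorToUV R L V t) := by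
  induction t with
  | zero => simp
  | add s t hs ht => simp only [smul_add, map_add, Submodule.coe_add, hs, ht]
  | tmul w v =>
    rw [TensorProduct.smul_tmul', tensorToUV_tmul, tensorToUV_tmul, smul_eq_mul, map_mul]
    rfl

theorem tensorToUV_surjective : Function.Surjective (tensorToUV R L V) := by
  have h : UV R L V ≤ LinearMap.range ((UV R L V).subtype ∘ₗ tensorToUV R L V) := by
    refine Submodule.span_le.2 ?_
    rintro _ ⟨u, v, rfl⟩
    exact ⟨u ⊗ₜ v, rfl⟩
  rintro ⟨a, ha⟩
  obtain ⟨t, ht⟩ := h ha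
  exact ⟨t, Subtype.ext ht⟩

/-- `𝒜` acts on `R × (U(L) ⊗ V)`: an element of `L` kills the first factor and multiplies the
second, and `v` sends `(r, m)` to `(0, r (1 ⊗ v))`. Evaluation at `(1, 0)` recovers `u ⊗ v` from `u
· v`. -/
theorem tensorToUV_injective : Function.Injective (tensorToUV R L V) := by
  let a : UniversalEnvelopingAlgebra R L →ₐ[R] Module.End R (UniversalEnvelopingAlgebra R L ⊗[R] V) :=
    Algebra.lsmul R R (UniversalEnvelopingAlgebra R L ⊗[R] V)
  let f : L →ₗ⁅R⁆ Module.End R (R × (UniversalEnvelopingAlgebra R L ⊗[R] V)) :=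
    { toFun := fun x => LinearMap.inr R R (UniversalEnvelopingAlgebra R L ⊗[R] V) ∘ₗ a (.ι R x) ∘ₗ LinearMap.snd R R (UniversalEnvelopingAlgebra R L ⊗[R] V)
      map_add' := fun x y => by rw [map_add, map_add]; ext <;> simp
      map_smul' := fun r x => by rw [map_smul, map_smul]; ext <;> simp
      map_lie' := fun {x y} => by
        rw [LieHom.map_lie]
        refine LinearMap.ext fun p => ?_
        simp only [LieRing.of_associative_ring_bracket, map_sub, map_mul]
        exact map_sub (LinearMap.inr R R (UniversalEnvelopingAlgebra R L ⊗[R] V)) _ _ }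
  let g : V →ₗ[R] Module.End R (R × (UniversalEnvelopingAlgebra R L ⊗[R] V)) :=
    (LinearMap.llcomp R (R × (UniversalEnvelopingAlgebra R L ⊗[R] V)) (UniversalEnvelopingAlgebra R L ⊗[R] V) (R × (UniversalEnvelopingAlgebra R L ⊗[R] V)) (LinearMap.inr R R (UniversalEnvelopingAlgebra R L ⊗[R] V))) ∘ₗ
      ((LinearMap.lsmul R (UniversalEnvelopingAlgebra R L ⊗[R] V)).flip.compl₂ (LinearMap.fst R R (UniversalEnvelopingAlgebra R L ⊗[R] V))) ∘ₗ (TensorProduct.mk R _ V 1)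
  let H := lift f g
  -- Since `x ∈ L` kills `(1, 0)`, the commutator `x c - c x` acts on that vector as `x c`; the
  -- adjoint action thus becomes left multiplication.
  have hU : ∀ (u : UniversalEnvelopingAlgebra R L) (m : (UniversalEnvelopingAlgebra R L ⊗[R] V)) (c : FreeAlgOver R L V),
      H c (1, 0) = (0, m) → H (adU R L V u c) (1, 0) = (0, u • m) := by
    intro u
    induction u using UniversalEnvelopingAlgebra.induction_on_gen with
    | halg r =>
      intro m c h
      rw [AlgHom.commutes, Module.algebraMap_end_apply, map_smul, LinearMap.smul_apply, h,
        algebraMap_smul]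
      simp
    | hgen x =>
      intro m c h
      rw [adU_ι, LieRing.of_associative_ring_bracket, map_sub, map_mul, map_mul, lift_inL,
        LinearMap.sub_apply, Module.End.mul_apply, Module.End.mul_apply, h]
      have h0 : f x (1, 0) = 0 := by simp [f]
      rw [h0, map_zero, sub_zero]
      rfl
    | hmul u w hu hw =>
      intro m c h
      rw [map_mul, Module.End.mul_apply, mul_smul]
      exact hu _ _ (hw _ _ h)
    | hadd u w hu hw =>
      intro m c h
      rw [map_add, LinearMap.add_apply, map_add, LinearMap.add_apply, hu _ _ h, hw _ _ h, add_smul]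
      simp
  have key : ∀ t : (UniversalEnvelopingAlgebra R L ⊗[R] V), (H (tensorToUV R L V t) (1, 0)).2 = t := by
    intro t
    induction t with
    | zero => simp
    | add s t hs ht => simp only [map_add, Submodule.coe_add, LinearMap.add_apply, Prod.snd_add,
        hs, ht]
    | tmul u v =>
      rw [tensorToUV_tmul, hU u (1 ⊗ₜ v)]
      · rw [TensorProduct.smul_tmul', smul_eq_mul, mul_one]
      · rw [lift_inV]
        simp [g]
  intro s t h
  rw [← key s, h, key t]

/-- `U(L) · V` is the free `U(L)`-module over `V`. -/
noncomputable def tensorEquivUV : (UniversalEnvelopingAlgebra R L ⊗[R] V) ≃ₗ[R] UV R L V :=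
  LinearEquiv.ofBijective _ ⟨tensorToUV_injective R L V, tensorToUV_surjective R L V⟩

end UV

end FreeAlgOver

/-! ### Derivations of tensor algebras -/

namespace TensorAlgebra

variable {R W : Type*} [CommRing R] [AddCommGroup W] [Module R W]

/-- The algebra homomorphism `t ↦ t + ε D t` whose second component is the derivation extending
a given endomorphism. -/
noncomputable def derivAux (D : Module.End R W) :
    TensorAlgebra R W →ₐ[R] TrivSqZeroExt (TensorAlgebra R W) (TensorAlgebra R W) :=
  lift R ((TrivSqZeroExt.inlAlgHom R (TensorAlgebra R W) (TensorAlgebra R W)).toLinearMap ∘ₗ ι R +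
    (TrivSqZeroExt.inrHom (TensorAlgebra R W) (TensorAlgebra R W)).restrictScalars R ∘ₗ ι R ∘ₗ D)

/-- The derivation of the tensor algebra that extends an endomorphism. -/
noncomputable def deriv (D : Module.End R W) : Module.End R (TensorAlgebra R W) :=
  (TrivSqZeroExt.sndHom (TensorAlgebra R W) (TensorAlgebra R W)).restrictScalars R ∘ₗ
    (derivAux D).toLinearMap

theorem fst_derivAux (D : Module.End R W) (t : TensorAlgebra R W) : (derivAux D t).fst = t := by
  have : (TrivSqZeroExt.fstHom R (TensorAlgebra R W) (TensorAlgebra R W)).comp (derivAux D) =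
      AlgHom.id R _ := by
    ext w
    simp [derivAux]
  exact DFunLike.congr_fun this t

theorem deriv_ι (D : Module.End R W) (w : W) : deriv D (ι R w) = ι R (D w) := by
  simp [deriv, derivAux]

theorem deriv_mul (D : Module.End R W) (s t : TensorAlgebra R W) :
    deriv D (s * t) = deriv D s * t + s * deriv D t := by
  have h : (derivAux D (s * t)).snd =
      (derivAux D s).snd * (derivAux D t).fst + (derivAux D s).fst * (derivAux D t).snd := by
    rw [map_mul, TrivSqZeroExt.snd_mul, add_comm]
    rfl
  rw [fst_derivAux, fst_derivAux] at h
  exact h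

/-- A derivation along `φ` vanishes at `1`, so it is determined by its values on generators. -/
theorem leibniz_ext {B : Type*} [Ring B] [Algebra R B] {D₁ D₂ : TensorAlgebra R W →ₗ[R] B}
    (φ : TensorAlgebra R W →ₐ[R] B)
    (h₁ : ∀ s t, D₁ (s * t) = D₁ s * φ t + φ s * D₁ t)
    (h₂ : ∀ s t, D₂ (s * t) = D₂ s * φ t + φ s * D₂ t)
    (h : ∀ w, D₁ (ι R w) = D₂ (ι R w)) : D₁ = D₂ := by
  have hone : ∀ D : TensorAlgebra R W →ₗ[R] B,
      (∀ s t, D (s * t) = D s * φ t + φ s * D t) → D 1 = 0 := by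
    intro D hD
    simpa using hD 1 1
  refine LinearMap.ext fun t => ?_
  induction t using TensorAlgebra.induction with
  | algebraMap r =>
    rw [Algebra.algebraMap_eq_smul_one, map_smul, map_smul, hone _ h₁, hone _ h₂]
  | ι w => exact h w
  | mul a b ha hb => rw [h₁, h₂, ha, hb]
  | add a b ha hb => rw [map_add, map_add, ha, hb]

/-- A representation on `W` extends to the tensor algebra by derivations. -/
noncomputable def derivHom {L : Type*} [LieRing L] [LieAlgebra R L] (D : L →ₗ⁅R⁆ Module.End R W) :
    L →ₗ⁅R⁆ Module.End R (TensorAlgebra R W) where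
  toFun x := deriv (D x)
  map_add' x y := leibniz_ext (AlgHom.id R _) (deriv_mul _)
    (fun s t => by
      simp only [LinearMap.add_apply, deriv_mul, AlgHom.id_apply, add_mul, mul_add]
      abel)
    (fun w => by simp only [deriv_ι, map_add, LinearMap.add_apply])
  map_smul' r x := leibniz_ext (AlgHom.id R _) (deriv_mul _)
    (fun s t => by
      simp only [LinearMap.smul_apply, deriv_mul, AlgHom.id_apply, RingHom.id_apply, smul_add,
        smul_mul_assoc, mul_smul_comm])
    (fun w => by simp only [deriv_ι, map_smul, LinearMap.smul_apply, RingHom.id_apply])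
  map_lie' {x y} := leibniz_ext (AlgHom.id R _) (deriv_mul _)
    (fun s t => by
      simp only [LieRing.of_associative_ring_bracket, LinearMap.sub_apply, Module.End.mul_apply,
        deriv_mul, map_add, AlgHom.id_apply, sub_mul, mul_sub]
      abel)
    (fun w => by
      simp only [LieHom.map_lie, LieRing.of_associative_ring_bracket, LinearMap.sub_apply,
        Module.End.mul_apply, deriv_ι, map_sub])

end TensorAlgebra

/-! ### Module algebras over enveloping algebras -/

/-- An action of a Lie algebra by derivations makes an algebra a module algebra over the enveloping
algebra. -/
noncomputable def ModuleAlgebraStr.ofDerivations {R L A : Type*} [CommRing R] [LieRing L]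
    [LieAlgebra R L] [Ring A] [Algebra R A] (D : L →ₗ⁅R⁆ Module.End R A)
    (hD : ∀ x a b, D x (a * b) = D x a * b + a * D x b) :
    ModuleAlgebraStr R (UniversalEnvelopingAlgebra R L) A where
  act := UniversalEnvelopingAlgebra.lift R D
  act_mul := by
    -- The claim is that multiplication `A ⊗ A → A` intertwines `E ∘ Δ` with the action on `A`. In
    -- this form it is multiplicative in `h`, and for `h ∈ L` it is the Leibniz rule.
    let E : UniversalEnvelopingAlgebra R L ⊗[R] UniversalEnvelopingAlgebra R L →ₐ[R]
        Module.End R (A ⊗[R] A) :=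
      (Module.endTensorEndAlgHom (R := R) (S := R) (A := R) (M := A) (N := A)).comp
        (Algebra.TensorProduct.map (UniversalEnvelopingAlgebra.lift R D)
          (UniversalEnvelopingAlgebra.lift R D))
    have hE : ∀ z a b, E z (a ⊗ₜ b) = TensorProduct.map
        ((UniversalEnvelopingAlgebra.lift R D).toLinearMap.flip a)
        ((UniversalEnvelopingAlgebra.lift R D).toLinearMap.flip b) z := by
      intro z a b
      induction z with
      | zero => simp
      | add s t hs ht => simp only [map_add, LinearMap.add_apply, hs, ht]
      | tmul x y => rfl
    have key : ∀ h z, UniversalEnvelopingAlgebra.lift R D h (LinearMap.mul' R A z) =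
        LinearMap.mul' R A (E (UniversalEnvelopingAlgebra.comulHom R L h) z) := by
      intro h
      induction h using UniversalEnvelopingAlgebra.induction_on_gen with
      | halg r =>
        intro z
        simp only [AlgHom.commutes, Module.algebraMap_end_apply, map_smul]
      | hgen x =>
        intro z
        induction z with
        | zero => simp
        | add s t hs ht => simp only [map_add, hs, ht]
        | tmul a b =>
          rw [hE, UniversalEnvelopingAlgebra.comulHom_ι]
          simp [hD, UniversalEnvelopingAlgebra.lift_ι_apply, -UniversalEnvelopingAlgebra.ι_apply]
      | hmul u w hu hw =>
        intro z
        simp only [map_mul, Module.End.mul_apply, hu, hw]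
      | hadd u w hu hw =>
        intro z
        simp only [map_add, LinearMap.add_apply, hu, hw]
    intro h a b
    rw [← hE]
    exact key h (a ⊗ₜ b)
  act_one h := by
    change _ = UniversalEnvelopingAlgebra.counitHom R L h • (1 : A)
    induction h using UniversalEnvelopingAlgebra.induction_on_gen with
    | halg r => simp only [AlgHom.commutes, Module.algebraMap_end_apply, Algebra.algebraMap_self_apply]
    | hgen x =>
      rw [UniversalEnvelopingAlgebra.lift_ι_apply, UniversalEnvelopingAlgebra.counitHom_ι, zero_smul]
      simpa using hD x 1 1
    | hmul u w hu hw =>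
      rw [map_mul, Module.End.mul_apply, hw, map_smul, hu, map_mul, smul_smul, mul_comm]
    | hadd u w hu hw => rw [map_add, LinearMap.add_apply, hu, hw, map_add, add_smul]

/-! ### Smash products -/

namespace SmashProduct

section General

variable {R H A : Type*} [CommRing R] [Ring H] [Bialgebra R H] [Ring A] [Algebra R A]
  (ρ : ModuleAlgebraStr R H A)

theorem induction {p : SmashProduct ρ → Prop} (zero : p 0) (mk : ∀ a h, p (mk ρ a h))
    (add : ∀ x y, p x → p y → p (x + y)) (x : SmashProduct ρ) : p x :=
  TensorProduct.induction_on (motive := p) x zero mk add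

theorem mk_one_mul_mk (a b : A) (k : H) : mk ρ a 1 * mk ρ b k = mk ρ (a * b) k := by
  change mulHom ρ (a ⊗ₜ[R] 1) (b ⊗ₜ[R] k) = (a * b) ⊗ₜ[R] k
  rw [mulHom_tmul, map_one, mul_one, leftHom_tmul]

theorem one_mk_mul_one_mk (h k : H) : mk ρ 1 h * mk ρ 1 k = mk ρ 1 (h * k) := by
  change mulHom ρ (1 ⊗ₜ[R] h) (1 ⊗ₜ[R] k) = 1 ⊗ₜ[R] (h * k)
  rw [mulHom_tmul_tmul]
  have h2 : ∀ z : H ⊗[R] H,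
      TensorProduct.map (LinearMap.mulLeft R 1 ∘ₗ ρ.act.toLinearMap.flip 1)
        (LinearMap.mulRight R k) z =
      TensorProduct.map (LinearMap.toSpanSingleton R A 1) (LinearMap.mulRight R k)
        ((Coalgebra.counit (R := R) (A := H)).rTensor H z) := by
    intro z
    induction z with
    | zero => simp
    | add s t hs ht => simp only [map_add, hs, ht]
    | tmul x y => simp [ρ.act_one]
  rw [h2, Coalgebra.rTensor_counit_comul]
  simp

/-- The inclusion of `A` in `A # H`. -/
noncomputable def includeLeft : A →ₐ[R] SmashProduct ρ :=
  AlgHom.ofLinearMap ((TensorProduct.mk R A H).flip 1) rfl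
    fun a b => (mk_one_mul_mk ρ a b 1).symm

/-- The inclusion of `H` in `A # H`. -/
noncomputable def includeRight : H →ₐ[R] SmashProduct ρ :=
  AlgHom.ofLinearMap (TensorProduct.mk R A H 1) rfl
    fun h k => (one_mk_mul_one_mk ρ h k).symm

theorem includeLeft_apply (a : A) : includeLeft ρ a = mk ρ a 1 := rfl

/-- The counit on the right factor provides a left inverse. -/
theorem includeLeft_injective : Function.Injective (includeLeft ρ) := by
  let r : A ⊗[R] H →ₗ[R] A :=
    (TensorProduct.rid R A).toLinearMap ∘ₗ (Coalgebra.counit (R := R) (A := H)).lTensor A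
  refine Function.LeftInverse.injective (g := r) fun a => ?_
  change r (a ⊗ₜ 1) = a
  simp [r]

end General

/-- This is `Δ(x) = x ⊗ 1 + 1 ⊗ x`. For `k = 1` it says that the commutator with `x` in the smash
product is the action of `x` on `A`. -/
theorem ι_mul_mk {R L A : Type*} [CommRing R] [LieRing L] [LieAlgebra R L] [Ring A] [Algebra R A]
    (ρ : ModuleAlgebraStr R (UniversalEnvelopingAlgebra R L) A) (x : L) (b : A)
    (k : UniversalEnvelopingAlgebra R L) :
    mk ρ 1 (.ι R x) * mk ρ b k = mk ρ (ρ.act (.ι R x) b) k + mk ρ b (.ι R x * k) := by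
  change mulHom ρ (1 ⊗ₜ[R] .ι R x) (b ⊗ₜ[R] k) =
    ρ.act (.ι R x) b ⊗ₜ[R] k + b ⊗ₜ[R] (.ι R x * k)
  rw [mulHom_tmul, map_one, one_mul, diagHom_tmul]
  change TensorProduct.map _ _ (UniversalEnvelopingAlgebra.comulHom R L (.ι R x)) = _
  rw [UniversalEnvelopingAlgebra.comulHom_ι]
  simp [-UniversalEnvelopingAlgebra.ι_apply]

end SmashProduct

/-! ### The free algebra as a smash product -/

namespace FreeAlgOver

variable (R L V : Type*) [CommRing R] [LieRing L] [LieAlgebra R L] [AddCommGroup V] [Module R V]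

/-- The adjoint action of `L` on `U(L) · V`. -/
noncomputable def adUV : L →ₗ⁅R⁆ Module.End R (UV R L V) where
  toFun x := (LieAlgebra.ad R (FreeAlgOver R L V) (inL R L V x)).restrict fun _ => lie_mem_UV x
  map_add' x y := LinearMap.ext fun a => Subtype.ext <|
    (congrArg (⁅·, (a : FreeAlgOver R L V)⁆) (map_add (inL R L V) x y)).trans (add_lie _ _ _)
  map_smul' r x := LinearMap.ext fun a => Subtype.ext <|
    (congrArg (⁅·, (a : FreeAlgOver R L V)⁆) (map_smul (inL R L V) r x)).trans (smul_lie _ _ _)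
  map_lie' {x y} := by
    ext a
    simp only [LieRing.of_associative_ring_bracket, LinearMap.sub_apply, Module.End.mul_apply]
    change ⁅inL R L V ⁅x, y⁆, (a : FreeAlgOver R L V)⁆ = _
    rw [LieHom.map_lie, lie_lie]
    rfl

theorem coe_adUV (x : L) (m : UV R L V) :
    (adUV R L V x m : FreeAlgOver R L V) = ⁅inL R L V x, (m : FreeAlgOver R L V)⁆ := rfl

/-- The `U(L)`-module algebra structure of `T(U(L) · V)`. -/
noncomputable def tensorModuleAlgebra :
    ModuleAlgebraStr R (UniversalEnvelopingAlgebra R L) (TensorAlgebra R (UV R L V)) :=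
  .ofDerivations (TensorAlgebra.derivHom (adUV R L V)) fun _ => TensorAlgebra.deriv_mul _

theorem tensorModuleAlgebra_act_ι (x : L) (t : TensorAlgebra R (UV R L V)) :
    (tensorModuleAlgebra R L V).act (.ι R x) t = TensorAlgebra.deriv (adUV R L V x) t := by
  change UniversalEnvelopingAlgebra.lift R (TensorAlgebra.derivHom (adUV R L V)) (.ι R x) t = _
  rw [UniversalEnvelopingAlgebra.lift_ι_apply]
  rfl

/-- The canonical map from `T(U(L) · V)`. -/
noncomputable abbrev tensorHom : TensorAlgebra R (UV R L V) →ₐ[R] FreeAlgOver R L V :=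
  TensorAlgebra.lift R (UV R L V).subtype

/-- For `u ∈ L` both sides are derivations along `tensorHom` that agree on `U(L) · V`. -/
theorem tensorHom_act (u : UniversalEnvelopingAlgebra R L) (t : TensorAlgebra R (UV R L V)) :
    tensorHom R L V ((tensorModuleAlgebra R L V).act u t) = adU R L V u (tensorHom R L V t) := by
  induction u using UniversalEnvelopingAlgebra.induction_on_gen generalizing t with
  | halg r => simp only [AlgHom.commutes, Module.algebraMap_end_apply, map_smul]
  | hgen x =>
    rw [tensorModuleAlgebra_act_ι, adU_ι]
    have : (tensorHom R L V).toLinearMap ∘ₗ TensorAlgebra.deriv (adUV R L V x) =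
        LieAlgebra.ad R _ (inL R L V x) ∘ₗ (tensorHom R L V).toLinearMap := by
      refine TensorAlgebra.leibniz_ext (tensorHom R L V) (fun s t => ?_) (fun s t => ?_) fun m => ?_
      · simp [TensorAlgebra.deriv_mul]
      · simp only [LinearMap.comp_apply, LieAlgebra.ad_apply, AlgHom.toLinearMap_apply, map_mul,
          LieRing.of_associative_ring_bracket]
        noncomm_ring
      · simp [TensorAlgebra.deriv_ι, coe_adUV]
    exact LinearMap.congr_fun this t
  | hmul u w hu hw => simp only [map_mul, Module.End.mul_apply, hu, hw]
  | hadd u w hu hw => simp only [map_add, LinearMap.add_apply, hu, hw]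

/-- The map `h₁ ⊗ h₂ ↦ (h₁ · c) h₂`. -/
noncomputable def adMul (c : FreeAlgOver R L V) :
    UniversalEnvelopingAlgebra R L ⊗[R] UniversalEnvelopingAlgebra R L →ₗ[R] FreeAlgOver R L V :=
  LinearMap.mul' R _ ∘ₗ TensorProduct.map ((adU R L V).toLinearMap.flip c) (inU R L V).toLinearMap

theorem adMul_tmul (c : FreeAlgOver R L V) (x y : UniversalEnvelopingAlgebra R L) :
    adMul R L V c (x ⊗ₜ y) = adU R L V x c * inU R L V y := rfl

/-- For `x ∈ L` this reads `(x c - c x) + c x = x c`, and it passes to products. It makes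
multiplication in `𝒜` compatible with the smash product. -/
theorem adMul_comul (u : UniversalEnvelopingAlgebra R L) (c : FreeAlgOver R L V) :
    adMul R L V c (UniversalEnvelopingAlgebra.comulHom R L u) = inU R L V u * c := by
  induction u using UniversalEnvelopingAlgebra.induction_on_gen generalizing c with
  | halg r =>
    rw [AlgHom.commutes, Algebra.TensorProduct.algebraMap_apply, adMul_tmul]
    simp [Algebra.smul_def]
  | hgen x =>
    rw [UniversalEnvelopingAlgebra.comulHom_ι, map_add, adMul_tmul, adMul_tmul, adU_ι, inU_ι,
      LieRing.of_associative_ring_bracket]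
    simp
  | hadd u w hu hw => simp only [map_add, add_mul, hu, hw]
  | hmul u w hu hw =>
    have h1 : ∀ (z : UniversalEnvelopingAlgebra R L ⊗[R] UniversalEnvelopingAlgebra R L)
        (x y : UniversalEnvelopingAlgebra R L),
        adMul R L V c (z * x ⊗ₜ y) = adMul R L V (adU R L V x c) z * inU R L V y := by
      intro z x y
      induction z with
      | zero => simp
      | add s t hs ht => simp only [add_mul, map_add, hs, ht]
      | tmul p q =>
        rw [Algebra.TensorProduct.tmul_mul_tmul, adMul_tmul, adMul_tmul, map_mul, map_mul,
          Module.End.mul_apply, mul_assoc]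
    have h2 : ∀ z, adMul R L V c (UniversalEnvelopingAlgebra.comulHom R L u * z) =
        inU R L V u * adMul R L V c z := by
      intro z
      induction z with
      | zero => simp
      | add s t hs ht => simp only [mul_add, map_add, hs, ht]
      | tmul x y => rw [h1, hu, adMul_tmul, mul_assoc]
    rw [map_mul, h2, hw, map_mul, mul_assoc]

/-- The linear map `t ⊗ h ↦ t h`. -/
noncomputable def smashLinear :
    SmashProduct (tensorModuleAlgebra R L V) →ₗ[R] FreeAlgOver R L V :=
  TensorProduct.lift ((LinearMap.mul R (FreeAlgOver R L V)).compl₁₂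
    (tensorHom R L V).toLinearMap (inU R L V).toLinearMap)

/-- The multiplication map from the smash product. -/
noncomputable def smashHom :
    SmashProduct (tensorModuleAlgebra R L V) →ₐ[R] FreeAlgOver R L V :=
  AlgHom.ofLinearMap (smashLinear R L V)
    (by
      change tensorHom R L V 1 * inU R L V 1 = 1
      simp)
    (by
      intro x y
      induction x using SmashProduct.induction with
      | zero => simp
      | add s t hs ht => simp only [add_mul, map_add, hs, ht]
      | mk a h =>
      induction y using SmashProduct.induction with
      | zero => simp
      | add s t hs ht => simp only [mul_add, map_add, hs, ht]
      | mk b k =>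
      have key : ∀ z : UniversalEnvelopingAlgebra R L ⊗[R] UniversalEnvelopingAlgebra R L,
          TensorProduct.lift ((LinearMap.mul R (FreeAlgOver R L V)).compl₁₂
            (tensorHom R L V).toLinearMap (inU R L V).toLinearMap)
            (TensorProduct.map
              (LinearMap.mulLeft R a ∘ₗ (tensorModuleAlgebra R L V).act.toLinearMap.flip b)
              (LinearMap.mulRight R k) z) =
          tensorHom R L V a * adMul R L V (tensorHom R L V b) z * inU R L V k := by
        intro z
        induction z with
        | zero => simp
        | add s t hs ht => simp only [map_add, mul_add, add_mul, hs, ht]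
        | tmul p q =>
          have := tensorHom_act R L V p b
          simp only [TensorProduct.map_tmul, TensorProduct.lift.tmul, LinearMap.compl₁₂_apply,
            AlgHom.toLinearMap_apply, LinearMap.comp_apply, LinearMap.flip_apply,
            LinearMap.mulLeft_apply, LinearMap.mulRight_apply, LinearMap.mul_apply', map_mul,
            adMul_tmul, this, mul_assoc]
      have h1 : SmashProduct.mk (tensorModuleAlgebra R L V) a h * SmashProduct.mk _ b k = _ :=
        SmashProduct.mulHom_tmul_tmul (tensorModuleAlgebra R L V) a b h k
      rw [h1]
      refine (key _).trans ?_
      refine (congrArg (fun w => tensorHom R L V a * w * inU R L V k)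
        (adMul_comul R L V h (tensorHom R L V b))).trans ?_
      change _ = (tensorHom R L V a * inU R L V h) * (tensorHom R L V b * inU R L V k)
      simp only [mul_assoc])

theorem smashHom_mk (t : TensorAlgebra R (UV R L V)) (u : UniversalEnvelopingAlgebra R L) :
    smashHom R L V (SmashProduct.mk _ t u) = tensorHom R L V t * inU R L V u := rfl

/-- The inverse of the multiplication map from the smash product. -/
noncomputable def toSmash : FreeAlgOver R L V →ₐ[R] SmashProduct (tensorModuleAlgebra R L V) :=
  lift
    ((SmashProduct.includeRight (tensorModuleAlgebra R L V) :
      UniversalEnvelopingAlgebra R L →ₗ⁅R⁆ _).comp (UniversalEnvelopingAlgebra.ι R))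
    ((SmashProduct.includeLeft (tensorModuleAlgebra R L V)).toLinearMap ∘ₗ TensorAlgebra.ι R ∘ₗ
      (inV R L V).codRestrict (UV R L V) inV_mem_UV)

theorem toSmash_inL (x : L) :
    toSmash R L V (inL R L V x) = SmashProduct.mk _ 1 (.ι R x) := lift_inL _ _ x

theorem toSmash_inU (u : UniversalEnvelopingAlgebra R L) :
    toSmash R L V (inU R L V u) = SmashProduct.mk _ 1 u := by
  have : (toSmash R L V).comp (inU R L V) = SmashProduct.includeRight _ :=
    UniversalEnvelopingAlgebra.algHom_ext fun x => by
      rw [AlgHom.comp_apply, inU_ι, toSmash_inL]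
      rfl
  exact DFunLike.congr_fun this u

/-- `toSmash` is prescribed only on `L` and `V`. The elements where the formula holds form an
`L`-stable subspace, because commutators with `L` in the smash product give the action. -/
theorem toSmash_coe (m : UV R L V) :
    toSmash R L V m = SmashProduct.includeLeft _ (TensorAlgebra.ι R m) := by
  let N : Submodule R (FreeAlgOver R L V) :=
    (LinearMap.eqLocus ((toSmash R L V).toLinearMap ∘ₗ (UV R L V).subtype)
      ((SmashProduct.includeLeft (tensorModuleAlgebra R L V)).toLinearMap ∘ₗ
        TensorAlgebra.ι R)).map (UV R L V).subtype
  have hN : UV R L V ≤ N := by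
    refine UV_le (fun v => ⟨⟨inV R L V v, inV_mem_UV v⟩, lift_inV _ _ v, rfl⟩) ?_
    rintro x _ ⟨m, hm, rfl⟩
    refine ⟨adUV R L V x m, ?_, rfl⟩
    have hm' : toSmash R L V m = SmashProduct.mk _ (TensorAlgebra.ι R m) 1 := hm
    change toSmash R L V ⁅inL R L V x, (m : FreeAlgOver R L V)⁆ =
      SmashProduct.mk _ (TensorAlgebra.ι R (adUV R L V x m)) 1
    rw [LieRing.of_associative_ring_bracket, map_sub, map_mul, map_mul, hm', toSmash_inL,
      SmashProduct.ι_mul_mk, SmashProduct.mk_one_mul_mk, tensorModuleAlgebra_act_ι,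
      TensorAlgebra.deriv_ι, mul_one, mul_one, add_sub_cancel_right]
  obtain ⟨m', hm', h⟩ := hN m.2
  obtain rfl : m' = m := Subtype.ext h
  exact hm'

theorem toSmash_tensorHom (t : TensorAlgebra R (UV R L V)) :
    toSmash R L V (tensorHom R L V t) = SmashProduct.mk _ t 1 := by
  have : (toSmash R L V).comp (tensorHom R L V) = SmashProduct.includeLeft _ := by
    refine TensorAlgebra.hom_ext (LinearMap.ext fun m => ?_)
    simp [toSmash_coe]
  exact DFunLike.congr_fun this t

/-- The free algebra is the smash product of `T(U(L) · V)` and `U(L)`. -/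
noncomputable def smashEquiv :
    SmashProduct (tensorModuleAlgebra R L V) ≃ₐ[R] FreeAlgOver R L V :=
  AlgEquiv.ofAlgHom (smashHom R L V) (toSmash R L V)
    (hom_ext
      (fun x => by
        rw [AlgHom.comp_apply, toSmash_inL, smashHom_mk, map_one, one_mul, inU_ι]
        rfl)
      (fun v => by
        have h := toSmash_coe R L V ⟨inV R L V v, inV_mem_UV v⟩
        rw [AlgHom.comp_apply, h, SmashProduct.includeLeft_apply, smashHom_mk]
        simp))
    (by
      refine AlgHom.ext fun x => ?_
      induction x using SmashProduct.induction with
      | zero => simp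
      | add s t hs ht => rw [map_add, hs, ht, map_add]
      | mk a h =>
        rw [AlgHom.comp_apply, smashHom_mk, map_mul, toSmash_tensorHom, toSmash_inU,
          SmashProduct.mk_one_mul_mk, mul_one]
        rfl)

/-- Followed by `toSmash`, it is the inclusion of the left factor in the smash product. -/
theorem tensorHom_injective : Function.Injective (tensorHom R L V) := by
  intro s t h
  apply SmashProduct.includeLeft_injective (tensorModuleAlgebra R L V)
  rw [SmashProduct.includeLeft_apply, SmashProduct.includeLeft_apply, ← toSmash_tensorHom, h,
    toSmash_tensorHom]

/-- The subalgebra generated by `U(L) · V` is the tensor algebra. -/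
noncomputable def tensorEquivAdjoin : TensorAlgebra R (UV R L V) ≃ₐ[R]
    Algebra.adjoin R (UV R L V : Set (FreeAlgOver R L V)) :=
  (AlgEquiv.ofInjective _ (tensorHom_injective R L V)).trans
    (Subalgebra.equivOfEq _ _ (by rw [TensorAlgebra.range_lift]; simp))

end FreeAlgOver

/-! ### Free Lie algebras -/

namespace FreeLieOver

section Lift

variable {R W K : Type*} [CommRing R] [AddCommGroup W] [Module R W] [LieRing K] [LieAlgebra R K]

/-- The Lie algebra homomorphism extending a linear map. -/
noncomputable def lift (f : W →ₗ[R] K) : FreeLieOver R W →ₗ⁅R⁆ K := (existsUnique_lift R f).choose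

@[simp]
theorem lift_ι (f : W →ₗ[R] K) (w : W) : lift f (ι R w) = f w :=
  (existsUnique_lift R f).choose_spec.1 w

theorem hom_ext {h k : FreeLieOver R W →ₗ⁅R⁆ K} (H : ∀ w, h (ι R w) = k (ι R w)) : h = k :=
  (existsUnique_lift R ((k : FreeLieOver R W →ₗ[R] K) ∘ₗ ι R)).unique H fun _ => rfl

/-- An element lies in the Lie subalgebra generated by `W`. -/
theorem mem_lieSpan (z : FreeLieOver R W) :
    z ∈ LieSubalgebra.lieSpan R (FreeLieOver R W) (Set.range (ι R)) := by
  let S := LieSubalgebra.lieSpan R (FreeLieOver R W) (Set.range (ι R))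
  let f : W →ₗ[R] S := (ι R).codRestrict S.toSubmodule
    fun w => LieSubalgebra.subset_lieSpan ⟨w, rfl⟩
  have h : S.incl.comp (lift f) = LieHom.id := hom_ext fun w => by
    rw [LieHom.comp_apply, lift_ι]
    rfl
  have hz : (lift f z : FreeLieOver R W) = z := LieHom.congr_fun h z
  exact hz ▸ (lift f z).2

theorem range_lift (f : W →ₗ[R] K) :
    (lift f).range = LieSubalgebra.lieSpan R K (Set.range f) := by
  apply le_antisymm
  · rintro _ ⟨z, rfl⟩
    have h : LieSubalgebra.lieSpan R (FreeLieOver R W) (Set.range (ι R)) ≤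
        (LieSubalgebra.lieSpan R K (Set.range f)).comap (lift f) := by
      rw [LieSubalgebra.lieSpan_le]
      rintro _ ⟨w, rfl⟩
      exact LieSubalgebra.subset_lieSpan ⟨w, (lift_ι f w).symm⟩
    exact h (mem_lieSpan z)
  · rw [LieSubalgebra.lieSpan_le]
    rintro _ ⟨w, rfl⟩
    exact ⟨ι R w, lift_ι f w⟩

end Lift

/-- The free Lie algebra over a vector space embeds in the tensor algebra. -/
theorem lift_tensor_injective (F W : Type*) [Field F] [AddCommGroup W] [Module F W] :
    Function.Injective (lift (TensorAlgebra.ι F : W →ₗ[F] TensorAlgebra F W)) := by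
  let i : FreeLieOver F W →ₗ⁅F⁆ UniversalEnvelopingAlgebra F (FreeLieOver F W) :=
    UniversalEnvelopingAlgebra.ι F
  -- The injective map `F(W) → U(F(W))` factors through the map to `T(W)`, followed by `H`.
  let H : TensorAlgebra F W →ₐ[F] UniversalEnvelopingAlgebra F (FreeLieOver F W) :=
    TensorAlgebra.lift F ((i : FreeLieOver F W →ₗ[F] _) ∘ₗ ι F)
  have h : (H : TensorAlgebra F W →ₗ⁅F⁆ _).comp (lift (TensorAlgebra.ι F)) = i :=
    hom_ext fun w => by
      rw [LieHom.comp_apply, lift_ι]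
      exact TensorAlgebra.lift_ι_apply _ _
  intro a b hab
  apply UniversalEnvelopingAlgebra.ι_injective F (FreeLieOver F W)
  change i a = i b
  rw [← h, LieHom.comp_apply, hab, LieHom.comp_apply]

end FreeLieOver

/-- A Lie algebra homomorphism from the free Lie algebra that is injective identifies it with the
Lie subalgebra generated by the image of `W`. -/
theorem exists_freeLieOver_equiv_lieSpan {R W K : Type*} [CommRing R] [AddCommGroup W] [Module R W]
    [LieRing K] [LieAlgebra R K] (f : W →ₗ[R] K) (hf : Function.Injective (FreeLieOver.lift f))
    {s : Set K} (hs : Set.range f = s) :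
    ∃ e : FreeLieOver R W ≃ₗ⁅R⁆ LieSubalgebra.lieSpan R K s,
      ∀ w, (e (FreeLieOver.ι R w) : K) = f w := by
  subst hs
  let j : FreeLieOver R W →ₗ⁅R⁆ LieSubalgebra.lieSpan R K (Set.range f) :=
    { toFun := fun z => ⟨FreeLieOver.lift f z, FreeLieOver.range_lift f ▸ ⟨z, rfl⟩⟩
      map_add' := fun x y => Subtype.ext (map_add _ x y)
      map_smul' := fun r x => Subtype.ext (map_smul _ r x)
      map_lie' := fun {x y} => Subtype.ext (LieHom.map_lie _ x y) }
  have hj : Function.Bijective j := by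
    refine ⟨fun x y h => hf (congrArg Subtype.val h), ?_⟩
    rintro ⟨a, ha⟩
    obtain ⟨z, hz⟩ : a ∈ (FreeLieOver.lift f).range := FreeLieOver.range_lift f ▸ ha
    exact ⟨z, Subtype.ext hz⟩
  exact ⟨LieEquiv.ofBijective j hj, fun w => FreeLieOver.lift_ι f w⟩

/-! ### The free Lie algebra on `U(L) · V` and the semidirect product -/

namespace FreeAlgOver

/-- The inclusion of `U(L) · V` in the Lie subalgebra generated by `L` and `V`. -/
noncomputable def lieInUV (R L V : Type*) [CommRing R] [LieRing L] [LieAlgebra R L]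
    [AddCommGroup V] [Module R V] : UV R L V →ₗ[R] lieSub R L V :=
  Submodule.inclusion (UV_le_lieSub R L V)

section Field

variable (F L V : Type*) [Field F] [LieRing L] [LieAlgebra F L] [AddCommGroup V] [Module F V]

/-- The map factors as `F(U(L) · V) → T(U(L) · V) → 𝒜`, and both maps are injective. -/
theorem lift_UV_injective : Function.Injective (FreeLieOver.lift (UV F L V).subtype) := by
  have h : (tensorHom F L V : TensorAlgebra F (UV F L V) →ₗ⁅F⁆ FreeAlgOver F L V).comp
      (FreeLieOver.lift (TensorAlgebra.ι F)) = FreeLieOver.lift (UV F L V).subtype :=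
    FreeLieOver.hom_ext fun w => by
      rw [LieHom.comp_apply, FreeLieOver.lift_ι, FreeLieOver.lift_ι]
      exact TensorAlgebra.lift_ι_apply _ _
  rw [← h]
  exact (tensorHom_injective F L V).comp (FreeLieOver.lift_tensor_injective F _)

theorem coe_lift_lieInUV (z : FreeLieOver F (UV F L V)) :
    (FreeLieOver.lift (lieInUV F L V) z : FreeAlgOver F L V) =
      FreeLieOver.lift (UV F L V).subtype z := by
  have h : (lieSub F L V).incl.comp (FreeLieOver.lift (lieInUV F L V)) =
      FreeLieOver.lift (UV F L V).subtype :=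
    FreeLieOver.hom_ext fun w => by
      rw [LieHom.comp_apply, FreeLieOver.lift_ι, FreeLieOver.lift_ι]
      rfl
  exact LieHom.congr_fun h z

theorem lift_lieInUV_injective : Function.Injective (FreeLieOver.lift (lieInUV F L V)) := by
  intro a b h
  apply lift_UV_injective F L V
  rw [← coe_lift_lieInUV, h, coe_lift_lieInUV]

theorem range_lieInUV : Set.range (lieInUV F L V) =
    {a : lieSub F L V | (a : FreeAlgOver F L V) ∈ UV F L V} := by
  ext a
  constructor
  · rintro ⟨m, rfl⟩
    exact m.2
  · intro ha
    exact ⟨⟨a, ha⟩, rfl⟩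

/-- `ad x` preserves the generating space `U(L) · V`, hence by the Leibniz rule the Lie subalgebra
that it generates. -/
theorem exists_lie_lift_lieInUV (x : L) (z : FreeLieOver F (UV F L V)) :
    ∃ z', FreeLieOver.lift (lieInUV F L V) z' =
      ⁅lieInL F L V x, FreeLieOver.lift (lieInUV F L V) z⁆ := by
  have hz := FreeLieOver.mem_lieSpan z
  induction hz using LieSubalgebra.lieSpan_induction with
  | mem z hz =>
    obtain ⟨m, rfl⟩ := hz
    refine ⟨FreeLieOver.ι F (adUV F L V x m), ?_⟩
    rw [FreeLieOver.lift_ι, FreeLieOver.lift_ι]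
    rfl
  | zero => exact ⟨0, by simp⟩
  | add y z _ _ hy hz =>
    obtain ⟨y', hy⟩ := hy
    obtain ⟨z', hz⟩ := hz
    exact ⟨y' + z', by rw [map_add, hy, hz, map_add, lie_add]⟩
  | smul r y _ hy =>
    obtain ⟨y', hy⟩ := hy
    exact ⟨r • y', by rw [map_smul, hy, map_smul, lie_smul]⟩
  | lie y z _ _ hy hz =>
    obtain ⟨y', hy⟩ := hy
    obtain ⟨z', hz⟩ := hz
    exact ⟨⁅y', z⁆ + ⁅y, z'⁆, by
      rw [map_add, LieHom.map_lie, LieHom.map_lie, hy, hz, LieHom.map_lie,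
        leibniz_lie (lieInL F L V x)]⟩

/-- Because `F(U(L) · V)` embeds in `𝔞`, the action is obtained by restricting `ad`, and each
identity it must satisfy is checked in `𝔞`. -/
theorem exists_freeLie_action :
    ∃ ψ : L →ₗ⁅F⁆ LieDerivation F (FreeLieOver F (UV F L V)) (FreeLieOver F (UV F L V)),
      ∀ x z, FreeLieOver.lift (lieInUV F L V) (ψ x z) =
        ⁅lieInL F L V x, FreeLieOver.lift (lieInUV F L V) z⁆ := by
  have hj := lift_lieInUV_injective F L V
  choose D hD using exists_lie_lift_lieInUV F L V
  let d : L → LieDerivation F (FreeLieOver F (UV F L V)) (FreeLieOver F (UV F L V)) := fun x =>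
    { toFun := D x
      map_add' := fun y z => hj (by rw [map_add, hD, hD, hD, map_add, lie_add])
      map_smul' := fun r z => hj (by
        rw [RingHom.id_apply, map_smul, hD, hD, map_smul, lie_smul])
      leibniz' := fun y z => hj (by
        simp only [LinearMap.coe_mk, AddHom.coe_mk]
        rw [map_sub, LieHom.map_lie, LieHom.map_lie, hD, hD, hD, LieHom.map_lie,
          leibniz_lie (lieInL F L V x), ← lie_skew ⁅lieInL F L V x, _⁆]
        abel) }
  have hd : ∀ x z, FreeLieOver.lift (lieInUV F L V) (d x z) =
        ⁅lieInL F L V x, FreeLieOver.lift (lieInUV F L V) z⁆ := hD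
  refine ⟨{ toFun := d, map_add' := fun x y => ?_, map_smul' := fun r x => ?_,
            map_lie' := fun {x y} => ?_ }, hd⟩
  · refine LieDerivation.ext fun z => hj ?_
    rw [LieDerivation.add_apply, map_add, hd, hd, hd, map_add, add_lie]
  · refine LieDerivation.ext fun z => hj ?_
    rw [RingHom.id_apply, LieDerivation.smul_apply, map_smul, hd, hd, map_smul, smul_lie]
  · refine LieDerivation.ext fun z => hj ?_
    rw [LieDerivation.lie_apply, map_sub, hd, hd, hd, hd, hd, LieHom.map_lie, lie_lie]

/-- The kernel of `toU` contains `V` and is a two-sided ideal, hence contains `U(L) · V` and the Lie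
algebra it generates. As `toU` is injective on `L` over a field, the free Lie algebra meets `L`
trivially. -/
theorem toU_lift_UV (z : FreeLieOver F (UV F L V)) :
    toU F L V (FreeLieOver.lift (UV F L V).subtype z) = 0 := by
  have hUV : UV F L V ≤ LinearMap.ker (toU F L V).toLinearMap :=
    UV_le (fun v => lift_inV _ _ v) fun x a ha => by
      have ha' : toU F L V a = 0 := ha
      change toU F L V ⁅_, a⁆ = 0
      rw [LieRing.of_associative_ring_bracket, map_sub, map_mul, map_mul, ha', mul_zero, zero_mul,
        sub_zero]
  have h : (toU F L V : FreeAlgOver F L V →ₗ⁅F⁆ UniversalEnvelopingAlgebra F L).comp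
      (FreeLieOver.lift (UV F L V).subtype) = 0 :=
    FreeLieOver.hom_ext fun w => by
      rw [LieHom.comp_apply, FreeLieOver.lift_ι]
      exact hUV w.2
  exact LieHom.congr_fun h z

open LieAlgebra in
theorem exists_semiDirectSum_equiv :
    ∃ (ψ : L →ₗ⁅F⁆ LieDerivation F (FreeLieOver F (UV F L V)) (FreeLieOver F (UV F L V)))
      (e : (FreeLieOver F (UV F L V) ⋊⁅ψ⁆ L) ≃ₗ⁅F⁆ lieSub F L V),
      (∀ m : UV F L V,
        (e (SemiDirectSum.inl ψ (FreeLieOver.ι F m)) : FreeAlgOver F L V) = m) ∧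
      ∀ x, e (SemiDirectSum.inr ψ x) = lieInL F L V x := by
  obtain ⟨ψ, hψ⟩ := exists_freeLie_action F L V
  let j := FreeLieOver.lift (lieInUV F L V)
  have hψ' : ∀ x z, j (ψ x z) = ⁅lieInL F L V x, j z⁆ := hψ
  let e₀ : (FreeLieOver F (UV F L V) ⋊⁅ψ⁆ L) →ₗ⁅F⁆ lieSub F L V :=
    { toFun := fun p => j p.left + lieInL F L V p.right
      map_add' := fun p q => by
        simp only [SemiDirectSum.add_eq_mk, map_add]
        abel
      map_smul' := fun r p => by
        simp only [SemiDirectSum.smul_eq_mk, map_smul, smul_add, RingHom.id_apply]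
      map_lie' := fun {p q} => by
        simp only [SemiDirectSum.lie_eq_mk, map_add, map_sub, LieHom.map_lie, hψ', lie_add,
          add_lie]
        rw [← lie_skew (j p.left) (lieInL F L V q.right)]
        abel }
  have he₀ : ∀ p, e₀ p = j p.left + lieInL F L V p.right := fun _ => rfl
  have hinl : ∀ m, e₀ (SemiDirectSum.inl ψ (FreeLieOver.ι F m)) = lieInUV F L V m := by
    intro m
    simp [he₀, j]
  have hinr : ∀ x, e₀ (SemiDirectSum.inr ψ x) = lieInL F L V x := by
    intro x
    simp [he₀]
  have hinj : Function.Injective e₀ := by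
    refine (injective_iff_map_eq_zero e₀).2 ?_
    rintro ⟨k, x⟩ h
    have h1 : FreeLieOver.lift (UV F L V).subtype k + inL F L V x = 0 := by
      rw [← coe_lift_lieInUV]
      exact congrArg Subtype.val h
    -- Projecting to `U(L)` isolates the `L`-component.
    have h2 := congrArg (toU F L V) h1
    rw [map_add, toU_lift_UV, map_zero, zero_add, toU, lift_inL] at h2
    have hx : x = 0 := UniversalEnvelopingAlgebra.ι_injective F L (by rw [h2, map_zero])
    subst hx
    rw [map_zero, add_zero] at h1
    have hk : k = 0 := lift_UV_injective F L V (by rw [h1, map_zero])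
    subst hk
    rfl
  have hsurj : Function.Surjective e₀ := by
    intro a
    suffices a ∈ e₀.range from this
    induction a using lieSub_induction with
    | hL x => exact ⟨_, hinr x⟩
    | hV v => exact ⟨_, hinl ⟨inV F L V v, inV_mem_UV v⟩⟩
    | h0 => exact zero_mem _
    | hadd a b ha hb => exact add_mem ha hb
    | hsmul r a ha => exact e₀.range.smul_mem r ha
    | hlie a b ha hb => exact e₀.range.lie_mem ha hb
  exact ⟨ψ, LieEquiv.ofBijective e₀ ⟨hinj, hsurj⟩,
    fun m => congrArg Subtype.val (hinl m), hinr⟩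

end Field

/-! ### The ideal generated by `V` -/

section Ideal

variable (R L V : Type*) [CommRing R] [LieRing L] [LieAlgebra R L] [AddCommGroup V] [Module R V]

/-- The normalizer of this Lie subalgebra is a Lie subalgebra containing `V`, which lies in it, and
`L`, which preserves its generators; so it is all of `𝔞`. -/
theorem lie_mem_lieSpan_UV (a : lieSub R L V) {b : lieSub R L V}
    (hb : b ∈ LieSubalgebra.lieSpan R (lieSub R L V)
      {a : lieSub R L V | (a : FreeAlgOver R L V) ∈ UV R L V}) :
    ⁅a, b⁆ ∈ LieSubalgebra.lieSpan R (lieSub R L V)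
      {a : lieSub R L V | (a : FreeAlgOver R L V) ∈ UV R L V} := by
  set K := LieSubalgebra.lieSpan R (lieSub R L V)
    {a : lieSub R L V | (a : FreeAlgOver R L V) ∈ UV R L V} with hK
  suffices a ∈ K.normalizer from (K.mem_normalizer_iff a).1 this b hb
  clear hb
  induction a using lieSub_induction with
  | hL x =>
    rw [K.mem_normalizer_iff]
    intro b hb
    induction hb using LieSubalgebra.lieSpan_induction with
    | mem b hb => exact LieSubalgebra.subset_lieSpan (lie_mem_UV x hb)
    | zero => rw [lie_zero]; exact zero_mem _
    | add b c _ _ hb hc => rw [lie_add]; exact add_mem hb hc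
    | smul r b _ hb => rw [lie_smul]; exact K.smul_mem r hb
    | lie b c hbK hcK hb hc =>
      rw [leibniz_lie]
      exact add_mem (K.lie_mem hb hcK) (K.lie_mem hbK hc)
  | hV v =>
    refine K.le_normalizer (LieSubalgebra.subset_lieSpan ?_)
    exact inV_mem_UV v
  | h0 => exact zero_mem _
  | hadd a b ha hb => exact add_mem ha hb
  | hsmul r a ha => exact K.normalizer.smul_mem r ha
  | hlie a b ha hb => exact K.normalizer.lie_mem ha hb

theorem coe_lieSpan_range_lieInV :
    ((LieSubmodule.lieSpan R (lieSub R L V) (Set.range (lieInV R L V)) :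
        LieIdeal R (lieSub R L V)) : Set (lieSub R L V)) =
      LieSubalgebra.lieSpan R (lieSub R L V)
        {a : lieSub R L V | (a : FreeAlgOver R L V) ∈ UV R L V} := by
  apply Set.Subset.antisymm
  · let K : LieIdeal R (lieSub R L V) :=
      { (LieSubalgebra.lieSpan R (lieSub R L V)
          {a : lieSub R L V | (a : FreeAlgOver R L V) ∈ UV R L V}).toSubmodule with
        lie_mem := fun {a _} hb => lie_mem_lieSpan_UV R L V a hb }
    have h : LieSubmodule.lieSpan R (lieSub R L V) (Set.range (lieInV R L V)) ≤ K := by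
      rw [LieSubmodule.lieSpan_le]
      rintro _ ⟨v, rfl⟩
      exact LieSubalgebra.subset_lieSpan (inV_mem_UV v)
    exact h
  · set I : LieIdeal R (lieSub R L V) :=
      LieSubmodule.lieSpan R (lieSub R L V) (Set.range (lieInV R L V)) with hI
    -- An ideal containing `V` is `L`-stable, so it contains `U(L) · V`; `UV_le` speaks of subspaces
    -- of `𝒜`, hence the image.
    have h : UV R L V ≤ I.toSubmodule.map (lieSub R L V).toSubmodule.subtype := by
      refine UV_le (fun v => ⟨lieInV R L V v, ?_, rfl⟩) ?_
      · exact LieSubmodule.subset_lieSpan ⟨v, rfl⟩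
      · rintro x _ ⟨a, ha, rfl⟩
        exact ⟨⁅lieInL R L V x, a⁆, I.lie_mem ha, rfl⟩
    have h2 : LieSubalgebra.lieSpan R (lieSub R L V)
        {a : lieSub R L V | (a : FreeAlgOver R L V) ∈ UV R L V} ≤
          LieIdeal.toLieSubalgebra R (lieSub R L V) I := by
      rw [LieSubalgebra.lieSpan_le]
      intro a ha
      obtain ⟨b, hb, hab⟩ := h ha
      obtain rfl : b = a := Subtype.ext hab
      exact hb
    exact h2

end Ideal

end FreeAlgOver

/-! ### The theorem -/

open FreeAlgOver in
theorem corollary2p2 (F : Type*) [Field F] (𝔤 : Type*) [LieRing 𝔤] [LieAlgebra F 𝔤]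
    (V : Type*) [AddCommGroup V] [Module F V] :
    -- `FreeAlgOver F 𝔤 V` is the algebra freely generated by `𝔤` and `V`
    (∀ (B : Type*) [Ring B] [Algebra F B] (f : 𝔤 →ₗ⁅F⁆ B) (g : V →ₗ[F] B),
      ∃! h : FreeAlgOver F 𝔤 V →ₐ[F] B,
        (∀ x, h (inL F 𝔤 V x) = f x) ∧ ∀ v, h (inV F 𝔤 V v) = g v) ∧
    -- equivalently, the algebra freely generated by `U(𝔤)` and `V`
    (∀ (B : Type*) [Ring B] [Algebra F B] (f : UniversalEnvelopingAlgebra F 𝔤 →ₐ[F] B)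
      (g : V →ₗ[F] B), ∃! h : FreeAlgOver F 𝔤 V →ₐ[F] B,
        (∀ u, h (inU F 𝔤 V u) = f u) ∧ ∀ v, h (inV F 𝔤 V v) = g v) ∧
    -- `𝔤 ⊂ U(𝔤)`, `U(𝔤) ⊂ 𝒜` and `V ⊂ 𝒜`
    Function.Injective (UniversalEnvelopingAlgebra.ι F : 𝔤 → UniversalEnvelopingAlgebra F 𝔤) ∧
    Function.Injective (inU F 𝔤 V) ∧
    Function.Injective (inV F 𝔤 V) ∧
    -- the Lie subalgebra `𝔞` generated by `𝔤` and `V` is the Lie algebra freely generated by them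
    (∀ (𝔟 : Type*) [LieRing 𝔟] [LieAlgebra F 𝔟] (f : 𝔤 →ₗ⁅F⁆ 𝔟) (g : V →ₗ[F] 𝔟),
      ∃! h : lieSub F 𝔤 V →ₗ⁅F⁆ 𝔟,
        (∀ x, h (lieInL F 𝔤 V x) = f x) ∧ ∀ v, h (lieInV F 𝔤 V v) = g v) ∧
    -- `𝒜 = U(𝔞)`
    (∃ e : UniversalEnvelopingAlgebra F (lieSub F 𝔤 V) ≃ₐ[F] FreeAlgOver F 𝔤 V,
      ∀ a : lieSub F 𝔤 V, e (UniversalEnvelopingAlgebra.ι F a) = a) ∧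
    -- the action of `U(𝔤)` extending the adjoint action of `𝔤` is the Hopf adjoint action
    (∀ u, adU F 𝔤 V u = hopfAdjoint (inU F 𝔤 V) u) ∧
    -- `U(𝔤) · V ⊂ 𝔞` is the `𝔤`-module generated by `V`, and it is the free `U(𝔤)`-module over `V`
    IsLeast {N : Submodule F (FreeAlgOver F 𝔤 V) |
      (∀ v, inV F 𝔤 V v ∈ N) ∧ ∀ x, ∀ a ∈ N, ⁅inL F 𝔤 V x, a⁆ ∈ N} (UV F 𝔤 V) ∧
    UV F 𝔤 V ≤ (lieSub F 𝔤 V).toSubmodule ∧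
    (∃ e : (UniversalEnvelopingAlgebra F 𝔤 ⊗[F] V) ≃ₗ[F] UV F 𝔤 V,
      (∀ v, (e (1 ⊗ₜ[F] v) : FreeAlgOver F 𝔤 V) = inV F 𝔤 V v) ∧
      ∀ (u : UniversalEnvelopingAlgebra F 𝔤) (t : UniversalEnvelopingAlgebra F 𝔤 ⊗[F] V),
        (e (u • t) : FreeAlgOver F 𝔤 V) = adU F 𝔤 V u (e t)) ∧
    -- the subalgebra generated by `U(𝔤) · V` is the tensor algebra `T(U(𝔤) · V)`
    (∃ e : TensorAlgebra F (UV F 𝔤 V) ≃ₐ[F]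
        Algebra.adjoin F (UV F 𝔤 V : Set (FreeAlgOver F 𝔤 V)),
      ∀ m : UV F 𝔤 V, (e (TensorAlgebra.ι F m) : FreeAlgOver F 𝔤 V) = m) ∧
    -- the Lie subalgebra (of `𝒜`, and of `𝔞`) generated by `U(𝔤) · V` is the free Lie algebra
    (∃ e : FreeLieOver F (UV F 𝔤 V) ≃ₗ⁅F⁆
        LieSubalgebra.lieSpan F (FreeAlgOver F 𝔤 V) (UV F 𝔤 V : Set (FreeAlgOver F 𝔤 V)),
      ∀ m : UV F 𝔤 V, (e (FreeLieOver.ι F m) : FreeAlgOver F 𝔤 V) = m) ∧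
    (∃ e : FreeLieOver F (UV F 𝔤 V) ≃ₗ⁅F⁆
        LieSubalgebra.lieSpan F (lieSub F 𝔤 V)
          {a : lieSub F 𝔤 V | (a : FreeAlgOver F 𝔤 V) ∈ UV F 𝔤 V},
      ∀ m : UV F 𝔤 V, ((e (FreeLieOver.ι F m) : lieSub F 𝔤 V) : FreeAlgOver F 𝔤 V) = m) ∧
    -- `𝒜` is the smash product `T(U(𝔤) · V) # U(𝔤)`, for the adjoint action of `U(𝔤)`
    (∃ ρ : ModuleAlgebraStr F (UniversalEnvelopingAlgebra F 𝔤) (TensorAlgebra F (UV F 𝔤 V)),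
      (∀ u t, TensorAlgebra.lift F (UV F 𝔤 V).subtype (ρ.act u t) =
        adU F 𝔤 V u (TensorAlgebra.lift F (UV F 𝔤 V).subtype t)) ∧
      ∃ e : SmashProduct ρ ≃ₐ[F] FreeAlgOver F 𝔤 V,
        ∀ t u, e (SmashProduct.mk ρ t u) =
          TensorAlgebra.lift F (UV F 𝔤 V).subtype t * inU F 𝔤 V u) ∧
    -- `𝔞` is the semidirect product `F(U(𝔤) · V) ⋊ 𝔤`
    (∃ (ψ : 𝔤 →ₗ⁅F⁆ LieDerivation F (FreeLieOver F (UV F 𝔤 V)) (FreeLieOver F (UV F 𝔤 V)))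
      (e : (FreeLieOver F (UV F 𝔤 V) ⋊⁅ψ⁆ 𝔤) ≃ₗ⁅F⁆ lieSub F 𝔤 V),
      (∀ m : UV F 𝔤 V,
        (e (LieAlgebra.SemiDirectSum.inl ψ (FreeLieOver.ι F m)) : FreeAlgOver F 𝔤 V) = m) ∧
      ∀ x, e (LieAlgebra.SemiDirectSum.inr ψ x) = lieInL F 𝔤 V x) ∧
    -- `F(U(𝔤) · V)` is the ideal of `𝔞` generated by `V`
    ((LieSubmodule.lieSpan F (lieSub F 𝔤 V) (Set.range (lieInV F 𝔤 V)) :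
        LieIdeal F (lieSub F 𝔤 V)) : Set (lieSub F 𝔤 V)) =
      LieSubalgebra.lieSpan F (lieSub F 𝔤 V)
        {a : lieSub F 𝔤 V | (a : FreeAlgOver F 𝔤 V) ∈ UV F 𝔤 V} := by
  refine ⟨fun B _ _ f g => existsUnique_lift f g, fun B _ _ f g => existsUnique_liftU f g,
    UniversalEnvelopingAlgebra.ι_injective F 𝔤, inU_injective F 𝔤 V, inV_injective F 𝔤 V,
    -- Over a field every `𝔟` is a free module.
    fun 𝔟 _ _ f g => lieSub_existsUnique_lift F 𝔤 V f g,
    ⟨lieSubEquiv F 𝔤 V, lieSubEquiv_ι F 𝔤 V⟩, adU_eq_hopfAdjoint F 𝔤 V, UV_isLeast F 𝔤 V,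
    UV_le_lieSub F 𝔤 V,
    ⟨tensorEquivUV F 𝔤 V, fun v => ?_, tensorToUV_smul F 𝔤 V⟩,
    ⟨tensorEquivAdjoin F 𝔤 V, fun m => TensorAlgebra.lift_ι_apply _ m⟩,
    exists_freeLieOver_equiv_lieSpan (UV F 𝔤 V).subtype (lift_UV_injective F 𝔤 V) (by simp), ?_,
    ⟨tensorModuleAlgebra F 𝔤 V, tensorHom_act F 𝔤 V, smashEquiv F 𝔤 V, smashHom_mk F 𝔤 V⟩,
    exists_semiDirectSum_equiv F 𝔤 V, coe_lieSpan_range_lieInV F 𝔤 V⟩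
  · refine (tensorToUV_tmul F 𝔤 V 1 v).trans ?_
    rw [map_one, Module.End.one_apply]
  · obtain ⟨e, he⟩ := exists_freeLieOver_equiv_lieSpan (lieInUV F 𝔤 V)
      (lift_lieInUV_injective F 𝔤 V) (range_lieInUV F 𝔤 V)
    exact ⟨e, fun m => congrArg Subtype.val (he m)⟩
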